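/- Let $H$ be an infinite-dimensional separable complex Hilbert space with inner product $(\cdot,\cdot)$ and norm $\|\cdot\|$. Let $\mathbf a[\cdot,\cdot]$ be a closed Hermitian sesquilinear form with domain $H^1$ dense in $H$, positive in the sense that $\mathbf a[u,u]\ge c\|u\|^2$ for all $u\in H^1$ and some $c>0$; regard $H^1$ as a Hilbert space with inner product $\mathbf a[\cdot,\cdot]$. Let $H_0^1$ be a closed subspace of $H^1$ which is dense in $H$. Let $A_N$ and $A_D$ be the self-adjoint operators in $H$ generated by $\mathbf a$ and by the restriction of $\mathbf a$ to $H_0^1$, respectively. Let $H^1_A$ be the set of $u\in H^1$ for which the functional $v\mapsto \mathbf a[u,v]$ on $H_0^1$ is continuous in the norm of $H$, and let $A:H^1_A\to H$ be defined by $(Au,v)=\mathbf a[u,v]$ for all $v\in H_0^1$. For $\mu\in\mathbb R$ put $G_\mu=\{u\in H^1_A: Au=\mu u\}$, a closed subspace of $H^1$, let $\Pi'_\mu$ be the $H^1$-orthogonal projection onto $G_\mu$, and let $$\mathcal B_\mu=(I-\mu\,\Pi'_\mu A_N^{-1})|_{G_\mu},$$ a bounded self-adjoint operator in the Hilbert space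 $G_\mu$ with inner product $\mathbf a[\cdot,\cdot]$; equivalently $\mathbf a[\mathcal B_\mu u,v]=\mathbf a[u,v]-\mu(u,v)$ for $u,v\in G_\mu$. For $B\in\{N,D\}$ let $E_B(\mu)$ be the orthogonal projection in $H$ onto $\ker(A_B-\mu I)$. Let $\mathcal H_0$ be the closed subspace of $H$ spanned by all common eigenvectors of $A_N$ and $A_D$, let $\mathcal H$ be its orthogonal complement in $H$, and put $n_{N,D}(\mu)=\dim E_B(\mu)\mathcal H_0$ (which is the same for $B=N$ and $B=D$) and $n_B(\mu)=\dim E_B(\mu)\mathcal H$. Let $\lambda\in\mathbb R$ with $\lambda\notin\sigma_{\mathrm{ess}}(A_N)\cup\sigma_{\mathrm{ess}}(A_D)$. Then there is $\varepsilon_0>0$ such that for every $\varepsilon\in(0,\varepsilon_0)$ there is $\delta>0$ for which the following holds, eigenvalues being counted according to their multiplicities. 1. $\sigma(\mathcal B_\lambda)\cap(-\varepsilon,\varepsilon)$ consists of exactly $n_N(\lambda)+n_D(\lambda)+n_{N,D}(\lambda)$ eigenvalues, all equal to zero. 2. For every $\mu\in(\lambda-\delta,\lambda)$, $\sigma(\mathcal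 B_\mu)\cap(-\varepsilon,\varepsilon)$ consists of exactly $n_D(\lambda)$ negative and $n_N(\lambda)$ positive eigenvalues (in particular $0\notin\sigma(\mathcal B_\mu)$). 3. For every $\mu\in(\lambda,\lambda+\delta)$, $\sigma(\mathcal B_\mu)\cap(-\varepsilon,\varepsilon)$ consists of exactly $n_N(\lambda)$ negative and $n_D(\lambda)$ positive eigenvalues (in particular $0\notin\sigma(\mathcal B_\mu)$). -/

import Mathlib

open Filter Topology

noncomputable section

/-- A densely defined, closed, positive definite Hermitian form on a complex Hilbert space.
The form is conjugate-linear in the first variable, as are Mathlib's inner products. -/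
structure ClosedPositiveForm (H : Type*) [NormedAddCommGroup H] [InnerProductSpace ℂ H] where
  /-- the form domain `H¹` -/
  domain : Submodule ℂ H
  dense_domain : Dense (domain : Set H)
  /-- the sesquilinear form `a[·,·]` -/
  form : domain →ₗ⋆[ℂ] domain →ₗ[ℂ] ℂ
  symm : ∀ u v, starRingEnd ℂ (form u v) = form v u
  positive : ∃ c : ℝ, 0 < c ∧ ∀ u : domain, c * ‖(u : H)‖ ^ 2 ≤ (form u u).re
  closed : ∀ (u : ℕ → domain) (x : H), Tendsto (fun n => (u n : H)) atTop (𝓝 x) →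
    (∀ ε : ℝ, 0 < ε → ∃ N, ∀ m, N ≤ m → ∀ n, N ≤ n →
      (form (u m - u n) (u m - u n)).re < ε) →
    ∃ y : domain, (y : H) = x ∧
      Tendsto (fun n => (form (u n - y) (u n - y)).re) atTop (𝓝 0)

namespace ClosedPositiveForm

variable {H : Type*} [NormedAddCommGroup H] [InnerProductSpace ℂ H]

/-- `H¹` regarded as a Hilbert space with the inner product `a[·,·]`. -/
def Space (a : ClosedPositiveForm H) : Type _ := a.domain

instance (a : ClosedPositiveForm H) : AddCommGroup a.Space :=
  inferInstanceAs (AddCommGroup a.domain)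

instance (a : ClosedPositiveForm H) : Module ℂ a.Space :=
  inferInstanceAs (Module ℂ a.domain)

/-- The inner product `a[·,·]` on `H¹`. -/
@[reducible]
def core (a : ClosedPositiveForm H) : InnerProductSpace.Core ℂ a.Space where
  inner u v := a.form u v
  conj_inner_symm u v := a.symm v u
  re_inner_nonneg u := by
    obtain ⟨c, hc, h⟩ := a.positive
    exact le_trans (by positivity) (h u)
  add_left u v w := LinearMap.map_add₂ a.form u v w
  smul_left u v r := LinearMap.map_smulₛₗ₂ a.form r u v
  definite u hu := by
    obtain ⟨c, hc, h⟩ := a.positive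
    have h1 := h u
    have h2 : (a.form u u).re = 0 := by
      have := congrArg Complex.re hu
      simpa using this
    rw [h2] at h1
    have h3 : ‖((show a.domain from u) : H)‖ ^ 2 ≤ 0 := by
      by_contra hcon
      push Not at hcon
      have := mul_pos hc hcon
      linarith
    have h4 : ((show a.domain from u) : H) = 0 := by
      have : ‖((show a.domain from u) : H)‖ = 0 := by
        have := sq_nonneg ‖((show a.domain from u) : H)‖
        exact pow_eq_zero_iff (two_ne_zero) |>.1 (le_antisymm h3 this)
      exact norm_eq_zero.1 this
    exact Subtype.ext h4

instance (a : ClosedPositiveForm H) : NormedAddCommGroup a.Space :=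
  a.core.toNormedAddCommGroup

instance (a : ClosedPositiveForm H) : InnerProductSpace ℂ a.Space :=
  InnerProductSpace.ofCore a.core.toCore

theorem inner_def (a : ClosedPositiveForm H) (u v : a.Space) :
    inner ℂ u v = a.form u v := rfl

theorem norm_sq_def (a : ClosedPositiveForm H) (u : a.Space) :
    ‖u‖ ^ 2 = (a.form u u).re := by
  rw [← inner_def, ← inner_self_eq_norm_sq (𝕜 := ℂ)]; rfl

/-- The embedding `H¹ → H` as a linear map. -/
def inclₗ (a : ClosedPositiveForm H) : a.Space →ₗ[ℂ] H := a.domain.subtype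

theorem exists_incl_bound (a : ClosedPositiveForm H) :
    ∃ C : ℝ, ∀ u : a.Space, ‖a.inclₗ u‖ ≤ C * ‖u‖ := by
  obtain ⟨c, hc, h⟩ := a.positive
  refine ⟨Real.sqrt c⁻¹, fun u => ?_⟩
  refine abs_le_of_sq_le_sq' ?_ (by positivity) |>.2
  rw [mul_pow, Real.sq_sqrt (by positivity), norm_sq_def]
  have h1 : c * ‖a.inclₗ u‖ ^ 2 ≤ (a.form u u).re := h u
  rw [inv_mul_eq_div, le_div_iff₀ hc]
  linarith

/-- The continuous embedding `H¹ → H`. -/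
def incl (a : ClosedPositiveForm H) : a.Space →L[ℂ] H :=
  ⟨a.inclₗ, by
    obtain ⟨C, hC⟩ := a.exists_incl_bound
    exact AddMonoidHomClass.continuous_of_bound a.inclₗ C hC⟩

theorem incl_injective (a : ClosedPositiveForm H) : Function.Injective a.incl :=
  a.domain.injective_subtype

theorem range_incl (a : ClosedPositiveForm H) : Set.range a.incl = (a.domain : Set H) :=
  Subtype.range_coe

instance [CompleteSpace H] (a : ClosedPositiveForm H) : CompleteSpace a.Space := by
  refine Metric.complete_of_cauchySeq_tendsto fun u hu => ?_
  have hi : CauchySeq (fun n => a.incl (u n)) := hu.map a.incl.uniformContinuous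
  obtain ⟨x, hx⟩ := cauchySeq_tendsto_of_complete hi
  obtain ⟨y, -, hy⟩ := a.closed u x hx (by
    intro ε hε
    obtain ⟨N, hN⟩ := Metric.cauchySeq_iff.1 hu (Real.sqrt ε) (Real.sqrt_pos.2 hε)
    refine ⟨N, fun m hm n hn => ?_⟩
    have h1 := hN m hm n hn
    rw [dist_eq_norm] at h1
    have h2 : ‖u m - u n‖ ^ 2 < ε := by
      rw [← Real.sq_sqrt hε.le]
      exact pow_lt_pow_left₀ h1 (norm_nonneg _) two_ne_zero
    rw [norm_sq_def] at h2
    exact h2)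
  let y' : a.Space := y
  refine ⟨y', ?_⟩
  rw [tendsto_iff_norm_sub_tendsto_zero]
  have h3 : Tendsto (fun n => ‖u n - y'‖ ^ 2) atTop (𝓝 0) := by
    refine hy.congr fun n => ?_
    rw [norm_sq_def]; rfl
  have h4 := h3.sqrt
  simpa [Real.sqrt_sq] using h4

/-- The graph of the operator `T` determined by `u ∈ U` and `(T u, v) = a[u, v]` for all
`v ∈ W`, where `U`, `W` are subspaces of `H¹`. -/
def opGraph (a : ClosedPositiveForm H) (U W : Submodule ℂ a.Space) : Submodule ℂ (H × H) where
  carrier := {p | ∃ u ∈ U, a.incl u = p.1 ∧ ∀ v ∈ W, inner ℂ p.2 (a.incl v) = inner ℂ u v}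
  zero_mem' := ⟨0, U.zero_mem, by simp, by simp⟩
  add_mem' := by
    rintro p q ⟨u, hu, hp, h⟩ ⟨u', hu', hq, h'⟩
    refine ⟨u + u', U.add_mem hu hu', by simp [hp, hq], fun v hv => ?_⟩
    rw [Prod.snd_add, inner_add_left, inner_add_left, h v hv, h' v hv]
  smul_mem' := by
    rintro c p ⟨u, hu, hp, h⟩
    refine ⟨c • u, U.smul_mem c hu, by simp [hp], fun v hv => ?_⟩
    rw [Prod.smul_snd, inner_smul_left, inner_smul_left, h v hv]

/-- The operator in `H` with graph `a.opGraph U W` (it is a graph when `W` is dense in `H`). -/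
def op (a : ClosedPositiveForm H) (U W : Submodule ℂ a.Space) : H →ₗ.[ℂ] H :=
  (a.opGraph U W).toLinearPMap

theorem op_graph (a : ClosedPositiveForm H) {U W : Submodule ℂ a.Space}
    (hW : Dense (a.incl '' W)) : (a.op U W).graph = a.opGraph U W := by
  refine Submodule.toLinearPMap_graph_eq _ ?_
  rintro ⟨x, f⟩ ⟨u, -, hu, h⟩ hx
  have hu0 : u = 0 := a.incl_injective (by simpa [hu] using hx)
  subst hu0
  refine hW.eq_zero_of_inner_left ℂ ?_
  rintro _ ⟨v, hv, rfl⟩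
  simpa using h v hv

/-- The operator `A_N` generated by the form `a`. -/
def opN (a : ClosedPositiveForm H) : H →ₗ.[ℂ] H := a.op ⊤ ⊤

/-- The inverse of `A_N`, as a bounded operator from `H` to the Hilbert space `H¹`;
see `mem_graph_opN`. -/
def invN [CompleteSpace H] (a : ClosedPositiveForm H) : H →L[ℂ] a.Space :=
  ContinuousLinearMap.adjoint a.incl

theorem dense_incl_top (a : ClosedPositiveForm H) :
    Dense (a.incl '' ((⊤ : Submodule ℂ a.Space) : Set a.Space)) := by
  rw [Submodule.top_coe, Set.image_univ, range_incl]
  exact a.dense_domain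

theorem mem_graph_opN [CompleteSpace H] (a : ClosedPositiveForm H) (x f : H) :
    (x, f) ∈ a.opN.graph ↔ x = a.incl (a.invN f) := by
  rw [opN, op_graph a a.dense_incl_top]
  constructor
  · rintro ⟨u, -, rfl, h⟩
    congr 1
    refine ext_inner_right ℂ fun v => ?_
    rw [invN, ContinuousLinearMap.adjoint_inner_left, ← h v trivial]
  · rintro rfl
    exact ⟨a.invN f, trivial, rfl, fun v _ => by
      rw [invN, ContinuousLinearMap.adjoint_inner_left]⟩

end ClosedPositiveForm

namespace PartialOp

variable {H : Type*} [NormedAddCommGroup H] [InnerProductSpace ℂ H]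

/-- `T - z` as a linear map on the domain of `T`. -/
def shift (T : H →ₗ.[ℂ] H) (z : ℂ) : T.domain →ₗ[ℂ] H :=
  T.toFun - z • T.domain.subtype

/-- `ker (T - z)` as a subspace of `H`. -/
def eigenspace (T : H →ₗ.[ℂ] H) (z : ℂ) : Submodule ℂ H :=
  (LinearMap.ker (shift T z)).map T.domain.subtype

theorem mem_eigenspace_iff (T : H →ₗ.[ℂ] H) (z : ℂ) (u : H) :
    u ∈ eigenspace T z ↔ (u, z • u) ∈ T.graph := by
  simp only [eigenspace, shift, Submodule.mem_map, LinearMap.mem_ker, LinearMap.sub_apply,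
    LinearMap.smul_apply, sub_eq_zero, LinearPMap.mem_graph_iff, Submodule.subtype_apply]
  constructor
  · rintro ⟨y, hy, rfl⟩
    exact ⟨y, rfl, hy⟩
  · rintro ⟨y, rfl, hy⟩
    exact ⟨y, hy, rfl⟩

/-- The essential spectrum: the points `z` at which `T - z` is not a Fredholm operator. For a
self-adjoint `T` this is the spectrum without the isolated eigenvalues of finite multiplicity. -/
def essSpectrum (T : H →ₗ.[ℂ] H) : Set ℂ :=
  {z | ¬ (FiniteDimensional ℂ (LinearMap.ker (shift T z)) ∧
    IsClosed (LinearMap.range (shift T z) : Set H) ∧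
    FiniteDimensional ℂ (H ⧸ LinearMap.range (shift T z)))}

/-- The orthogonal projection onto `ker (T - z)`. The closure changes nothing when `T` is a
closed operator. -/
def eigenproj [CompleteSpace H] (T : H →ₗ.[ℂ] H) (z : ℂ) : H →L[ℂ] H :=
  (eigenspace T z).topologicalClosure.starProjection

end PartialOp

/-- A pair of a form `a` with domain `H¹` and a subspace `H₀¹`, closed in the Hilbert space `H¹`
and dense in `H`. -/
structure FormPair (H : Type*) [NormedAddCommGroup H] [InnerProductSpace ℂ H] where
  /-- the form -/
  a : ClosedPositiveForm H
  /-- the subspace `H₀¹` -/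
  H₀ : Submodule ℂ a.Space
  isClosed_H₀ : IsClosed (H₀ : Set a.Space)
  dense_H₀ : Dense (a.incl '' H₀)

namespace FormPair

open PartialOp

variable {H : Type*} [NormedAddCommGroup H] [InnerProductSpace ℂ H]

/-- The operator `A_N` generated by the form on `H¹`. -/
def AN (P : FormPair H) : H →ₗ.[ℂ] H := P.a.opN

/-- The operator `A_D` generated by the restriction of the form to `H₀¹`. -/
def AD (P : FormPair H) : H →ₗ.[ℂ] H := P.a.op P.H₀ P.H₀

/-- The operator `A`: its domain is the set `H_A¹` of all `u ∈ H¹` for which `v ↦ a[u, v]` is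
`H`-continuous on `H₀¹`, and `(A u, v) = a[u, v]` for all `v ∈ H₀¹`. -/
def A (P : FormPair H) : H →ₗ.[ℂ] H := P.a.op ⊤ P.H₀

/-- The space `G_z = {u ∈ H_A¹ : A u = z u}`, as a subspace of the Hilbert space `H¹`. -/
def G (P : FormPair H) (z : ℂ) : Submodule ℂ P.a.Space :=
  (eigenspace P.A z).comap P.a.incl.toLinearMap

theorem mem_G_iff (P : FormPair H) (z : ℂ) (u : P.a.Space) :
    u ∈ P.G z ↔ ∀ v ∈ P.H₀, inner ℂ (z • P.a.incl u) (P.a.incl v) = inner ℂ u v := by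
  change P.a.incl u ∈ eigenspace P.A z ↔ _
  rw [mem_eigenspace_iff, A, ClosedPositiveForm.op_graph _ P.dense_H₀]
  constructor
  · rintro ⟨w, -, hw, h⟩
    obtain rfl := P.a.incl_injective hw
    exact h
  · intro h
    exact ⟨u, trivial, rfl, h⟩

theorem isClosed_G (P : FormPair H) (z : ℂ) : IsClosed (P.G z : Set P.a.Space) := by
  have : (P.G z : Set P.a.Space) = ⋂ v ∈ P.H₀,
      {u | inner ℂ (z • P.a.incl u) (P.a.incl v) = inner ℂ u v} := by
    ext u
    simp only [SetLike.mem_coe, mem_G_iff, Set.mem_iInter, Set.mem_ofPred_eq]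
  rw [this]
  refine isClosed_biInter fun v _ => isClosed_eq ?_ ?_ <;> fun_prop

instance [CompleteSpace H] (P : FormPair H) (z : ℂ) : CompleteSpace (P.G z) :=
  (P.isClosed_G z).completeSpace_coe

/-- The operator `𝓑_μ = (I - μ Π'_μ A_N⁻¹)|_{G_μ}` in `G_μ`, where `Π'_μ` is the
`H¹`-orthogonal projection onto `G_μ`. -/
def B [CompleteSpace H] (P : FormPair H) (μ : ℝ) : P.G (μ : ℂ) →L[ℂ] P.G (μ : ℂ) :=
  ContinuousLinearMap.id ℂ (P.G (μ : ℂ)) - (μ : ℂ) •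
    ((P.G (μ : ℂ)).orthogonalProjectionOnto ∘L P.a.invN ∘L P.a.incl ∘L (P.G (μ : ℂ)).subtypeL)

/-- The closed subspace `𝓗₀` spanned by the common eigenvectors of `A_N` and `A_D`. -/
def commonSpan (P : FormPair H) : Submodule ℂ H :=
  (Submodule.span ℂ {u | ∃ z w : ℂ, u ∈ eigenspace P.AN z ∧
    u ∈ eigenspace P.AD w}).topologicalClosure

/-- `n_{N,D}(μ) = dim E_B(μ) 𝓗₀`; both choices of `B` give the same subspace. -/
def nND [CompleteSpace H] (P : FormPair H) (μ : ℝ) : ℕ :=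
  Module.finrank ℂ (P.commonSpan.map (eigenproj P.AN μ).toLinearMap)

/-- `n_N(μ) = dim E_N(μ) 𝓗`, where `𝓗` is the orthogonal complement of `𝓗₀`. -/
def nN [CompleteSpace H] (P : FormPair H) (μ : ℝ) : ℕ :=
  Module.finrank ℂ (P.commonSpanᗮ.map (eigenproj P.AN μ).toLinearMap)

/-- `n_D(μ) = dim E_D(μ) 𝓗`, where `𝓗` is the orthogonal complement of `𝓗₀`. -/
def nD [CompleteSpace H] (P : FormPair H) (μ : ℝ) : ℕ :=
  Module.finrank ℂ (P.commonSpanᗮ.map (eigenproj P.AD μ).toLinearMap)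

end FormPair

/-- The real points of the spectrum of a bounded operator. -/
def realSpectrum {G : Type*} [NormedAddCommGroup G] [InnerProductSpace ℂ G]
    (T : G →L[ℂ] G) : Set ℝ :=
  {ν | (ν : ℂ) ∈ spectrum ℂ T}

/-- The spectrum of `T` in the set `S` consists of `n` eigenvalues, counted according to their
multiplicities. -/
def SpectrumConsistsOf {G : Type*} [NormedAddCommGroup G] [InnerProductSpace ℂ G]
    (T : G →L[ℂ] G) (S : Set ℝ) (n : ℕ) : Prop :=
  (realSpectrum T ∩ S).Finite ∧
  (∀ ν ∈ realSpectrum T ∩ S, Module.End.HasEigenvalue T.toLinearMap (ν : ℂ) ∧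
    FiniteDimensional ℂ (Module.End.eigenspace T.toLinearMap (ν : ℂ))) ∧
  ∑ᶠ ν ∈ realSpectrum T ∩ S,
    Module.finrank ℂ (Module.End.eigenspace T.toLinearMap (ν : ℂ)) = n

end

/-!
On `H¹` write `⟪·,·⟫` for the form and let `K` be its Gram operator, `⟪K u, v⟫ = (u, v)_H`, which
acts as `A_N⁻¹`. Then `G_μ` is the orthogonal complement in `H¹` of the image of `H₀¹` under
`1 - μK`, and `B_μ` is the compression of `1 - μK` to `G_μ`. The kernel of `A_N - λ` is
`N = ker (1 - λK)`, that of `A_D - λ` is the kernel `D` of the compression of `1 - λK` to `H₀¹`,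
and the common eigenvectors are `C = N ⊓ H₀¹ = N ⊓ D`.

At `μ = λ` the kernel of `B_λ` is `N + D`, and `B_λ` is bounded below on its complement. For
`μ ≠ λ` the operator `1 - μK` is invertible on `C`, so `C` splits off and leaves `G_μ`. Project the
vectors of `N` and of `D` orthogonal to `C` onto `G_μ`: to leading order the energy of the
projection of `m ∈ N` is `(λ - μ)(K m, m)`, and that of `m ∈ D` is `(μ - λ)` times a positive
quantity, while the images under `B_μ` are of order `|λ - μ|`. So `N` and `D` produce small
eigenvalues of opposite signs, and the lower bound on the complement of `N + D`, which persists
for `μ` near `λ`, shows that there are no others.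
-/

section ClosedRange

variable {𝕜 E F : Type*} [NontriviallyNormedField 𝕜]
  [NormedAddCommGroup E] [NormedSpace 𝕜 E] [NormedAddCommGroup F] [NormedSpace 𝕜 F]

/-- `a` maps `range (1 - z b a)` into `range (1 - z a b)`; conversely, if `a y = (1 - z a b) x`,
then `y = (1 - z b a) (y + z b x)`. -/
theorem isClosed_range_one_sub_smul_comp_comm {a : E →L[𝕜] F} {b : F →L[𝕜] E} {z : 𝕜}
    (h : IsClosed ((1 - z • (a ∘L b)).range : Set F)) :
    IsClosed ((1 - z • (b ∘L a)).range : Set E) := by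
  convert h.preimage a.continuous using 1
  ext y
  constructor
  · rintro ⟨x, rfl⟩
    exact ⟨a x, by simp⟩
  · rintro ⟨x, hx⟩
    have hx' : x = a y + z • a (b x) := by simpa [sub_eq_iff_eq_add] using hx
    refine ⟨y + z • b x, ?_⟩
    have hb : b x - z • b (a (b x)) = b (a y) := by
      rw [← map_smul, ← map_sub, sub_eq_of_eq_add hx']
    simp only [ContinuousLinearMap.coe_coe, sub_apply, one_apply_eq_self,
      smul_apply, ContinuousLinearMap.comp_apply, map_add, map_smul]
    rw [hb, sub_add_cancel]

variable [CompleteSpace E]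

theorem isClosed_map_of_bound (T : E →L[𝕜] F) {U : Submodule 𝕜 E} (hU : IsClosed (U : Set E))
    {c : ℝ} (hc : 0 < c) (hT : ∀ u ∈ U, c * ‖u‖ ≤ ‖T u‖) :
    IsClosed (U.map T.toLinearMap : Set F) := by
  have : CompleteSpace U := hU.completeSpace_coe
  have hanti : AntilipschitzWith c.toNNReal⁻¹ (T ∘L U.subtypeL) := by
    refine ContinuousLinearMap.antilipschitz_of_bound _ fun u => ?_
    rw [NNReal.coe_inv, Real.coe_toNNReal c hc.le, ← div_eq_inv_mul, le_div_iff₀' hc]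
    exact hT u u.2
  convert hanti.isClosed_range (T ∘L U.subtypeL).uniformContinuous
  ext y
  simp

theorem isClosed_range_of_bound_on_ker [CompleteSpace 𝕜] {W : Type*} [NormedAddCommGroup W]
    [NormedSpace 𝕜 W] [FiniteDimensional 𝕜 W] (T : E →L[𝕜] F) (φ : E →L[𝕜] W) {c : ℝ}
    (hc : 0 < c) (hT : ∀ u ∈ φ.ker, c * ‖u‖ ≤ ‖T u‖) : IsClosed (T.range : Set F) := by
  obtain ⟨Q, hQ⟩ := φ.ker.exists_isCompl
  have : FiniteDimensional 𝕜 Q :=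
    ((φ.ker.quotientEquivOfIsCompl Q hQ).symm.trans
      φ.toLinearMap.quotKerEquivRange).symm.finiteDimensional
  rw [LinearMap.range_eq_map, ← hQ.sup_eq_top, Submodule.map_sup]
  exact Submodule.isClosed_sup_finiteDimensional _ _
    (isClosed_map_of_bound T φ.isClosed_ker hc hT)

variable [CompleteSpace F]

theorem exists_norm_sub_ker_le (T : E →L[𝕜] F) (hT : IsClosed (T.range : Set F)) :
    ∃ c > 0, ∀ x, ∃ n ∈ T.ker, c * ‖x - n‖ ≤ ‖T x‖ := by
  have : CompleteSpace T.range := hT.completeSpace_coe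
  obtain ⟨C, hC, h⟩ := T.rangeRestrict.exists_preimage_norm_le
    T.toLinearMap.surjective_rangeRestrict
  refine ⟨C⁻¹, inv_pos.2 hC, fun x => ?_⟩
  obtain ⟨y, hyx, hy⟩ := h (T.rangeRestrict x)
  have hTy : T y = T x := congrArg Subtype.val hyx
  refine ⟨x - y, by simp [hTy], ?_⟩
  rw [sub_sub_cancel, inv_mul_le_iff₀ hC]
  exact hy

theorem isClosed_map_of_finiteDimensional_ker [CompleteSpace 𝕜] (T : E →L[𝕜] F)
    (hT : IsClosed (T.range : Set F)) [FiniteDimensional 𝕜 T.ker] {U : Submodule 𝕜 E}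
    (hU : IsClosed (U : Set E)) : IsClosed (U.map T.toLinearMap : Set F) := by
  have : CompleteSpace T.range := hT.completeSpace_coe
  have hquot := T.rangeRestrict.isQuotientMap T.toLinearMap.surjective_rangeRestrict
  have hpre : IsClosed (T.rangeRestrict ⁻¹' (Subtype.val ⁻¹' (U.map T.toLinearMap : Set F))) := by
    convert U.isClosed_sup_finiteDimensional T.ker hU
    rw [← Submodule.comap_map_eq]
    rfl
  convert hT.isClosedEmbedding_subtypeVal.isClosedMap _ (hquot.isClosed_preimage.1 hpre)
  exact (Subtype.image_preimage_coe _ _ ▸ Set.inter_eq_right.2 (LinearMap.map_le_range)).symm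

end ClosedRange

noncomputable section SpectralCounting

open Module Module.End

theorem isUnit_of_ker_eq_bot_of_isClosed_range {𝕜 E : Type*} [RCLike 𝕜] [NormedAddCommGroup E]
    [InnerProductSpace 𝕜 E] [CompleteSpace E] {T : E →L[𝕜] E} (hT : IsSelfAdjoint T)
    (hker : T.ker = ⊥) (hrange : IsClosed (T.range : Set E)) : IsUnit T := by
  have : CompleteSpace T.range := hrange.completeSpace_coe
  have hsurj : T.range = ⊤ := by
    rw [← Submodule.orthogonal_eq_bot_iff, T.orthogonal_range, hT.adjoint_eq, hker]
  exact T.isUnit_iff_bijective.2 ⟨LinearMap.ker_eq_bot.1 hker, LinearMap.range_eq_top.1 hsurj⟩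

variable {G : Type*} [NormedAddCommGroup G] [InnerProductSpace ℂ G] {B : G →L[ℂ] G}

theorem mem_realSpectrum_of_hasEigenvalue {t : ℝ} (ht : HasEigenvalue B.toLinearMap (t : ℂ)) :
    t ∈ realSpectrum B :=
  fun hunit => ht.mem_spectrum (hunit.map ContinuousLinearMap.toLinearMapRingHom)

theorem norm_map_of_mem_eigenspace {t : ℝ} {u : G}
    (hu : u ∈ eigenspace B.toLinearMap (t : ℂ)) : ‖B u‖ = |t| * ‖u‖ := by
  rw [show B u = (t : ℂ) • u from mem_eigenspace_iff.1 hu, norm_smul, Complex.norm_real,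
    Real.norm_eq_abs]

theorem norm_map_sum_eigenvectors_lt (hB : (B : G →ₗ[ℂ] G).IsSymmetric) {r : ℝ} {s : Finset ℝ}
    (hs : ∀ t ∈ s, |t| < r) {x : ∀ t : s, eigenspace B.toLinearMap ((t : ℝ) : ℂ)} (hx : x ≠ 0) :
    ‖B (∑ t, (x t : G))‖ < r * ‖∑ t, (x t : G)‖ := by
  have hort : OrthogonalFamily ℂ (fun t : s => eigenspace B.toLinearMap ((t : ℝ) : ℂ))
      fun t => (eigenspace B.toLinearMap ((t : ℝ) : ℂ)).subtypeₗᵢ :=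
    hB.orthogonalFamily_eigenspaces.comp (Complex.ofReal_injective.comp Subtype.val_injective)
  obtain ⟨t₀, ht₀⟩ := Function.ne_iff.1 hx
  have hr : 0 < r := (abs_nonneg _).trans_lt (hs t₀ t₀.2)
  have hnorm : ‖∑ t, (x t : G)‖ ^ 2 = ∑ t, ‖x t‖ ^ 2 := hort.norm_sum x Finset.univ
  have hmap : B (∑ t, (x t : G)) = ∑ t : s, (((t : ℝ) : ℂ) • x t :
      eigenspace B.toLinearMap ((t : ℝ) : ℂ)) := by
    rw [map_sum]
    exact Finset.sum_congr rfl fun t _ => mem_eigenspace_iff.1 (x t).2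
  have hnorm_map : ‖B (∑ t, (x t : G))‖ ^ 2 = ∑ t : s, (t : ℝ) ^ 2 * ‖x t‖ ^ 2 := by
    rw [hmap]
    refine (hort.norm_sum (fun t => ((t : ℝ) : ℂ) • x t) Finset.univ).trans ?_
    refine Finset.sum_congr rfl fun t _ => ?_
    rw [norm_smul, mul_pow, Complex.norm_real, Real.norm_eq_abs, sq_abs]
  have hsq : ∀ t : s, (t : ℝ) ^ 2 < r ^ 2 := fun t =>
    sq_lt_sq.2 ((hs t t.2).trans_le (le_abs_self r))
  refine lt_of_pow_lt_pow_left₀ 2 (by positivity) ?_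
  rw [hnorm_map, mul_pow, hnorm, Finset.mul_sum]
  refine Finset.sum_lt_sum (fun t _ => ?_) ⟨t₀, Finset.mem_univ _, ?_⟩
  · exact mul_le_mul_of_nonneg_right (hsq t).le (by positivity)
  · exact mul_lt_mul_of_pos_right (hsq t₀) (pow_pos (norm_pos_iff.2 ht₀) 2)

/-- A self-adjoint operator without spectrum in `(a, b)` satisfies `(B - a)(B - b) ≥ 0`. -/
theorem add_mul_re_inner_le_of_spectral_gap [CompleteSpace G] (hB : IsSelfAdjoint B) {a b : ℝ}
    (hab : a ≤ b) (hgap : Disjoint (realSpectrum B) (Set.Ioo a b)) (u : G) :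
    (a + b) * (inner ℂ (B u) u).re ≤ ‖B u‖ ^ 2 + a * b * ‖u‖ ^ 2 := by
  have hpos : 0 ≤ cfc (fun x : ℝ => (x - a) * (x - b)) B := by
    refine cfc_nonneg fun x hx => ?_
    have hx' : x ∈ realSpectrum B := by
      rwa [← spectrum.algebraMap_mem_iff ℂ] at hx
    have hxab := Set.disjoint_left.1 hgap hx'
    by_contra! hneg
    rcases mul_neg_iff.1 hneg with ⟨hxa, hxb⟩ | ⟨hxa, hxb⟩
    · exact hxab ⟨sub_pos.1 hxa, sub_neg.1 hxb⟩
    · linarith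
  have hcfc : cfc (fun x : ℝ => (x - a) * (x - b)) B = (B - (a : ℂ) • 1) * (B - (b : ℂ) • 1) := by
    rw [cfc_mul (fun x : ℝ => x - a) (fun x : ℝ => x - b) B,
      cfc_sub (fun x : ℝ => x) (fun _ => a) B,
      cfc_sub (fun x : ℝ => x) (fun _ => b) B, cfc_id' ℝ B, cfc_const a B, cfc_const b B,
      Algebra.algebraMap_eq_smul_one, Algebra.algebraMap_eq_smul_one]
    rfl
  have hsymm : IsSelfAdjoint (B - (a : ℂ) • (1 : G →L[ℂ] G)) :=
    hB.sub (IsSelfAdjoint.smul (Complex.conj_ofReal a) (.one _))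
  rw [hcfc, ContinuousLinearMap.nonneg_iff_isPositive] at hpos
  have h : 0 ≤ (inner ℂ (B u - (a : ℂ) • u) (B u - (b : ℂ) • u)).re := by
    have h := hpos.re_inner_nonneg_right u
    rwa [mul_apply_eq_comp, ← hsymm.isSymmetric.apply_clm] at h
  have hnorm : ∀ v : G, (inner ℂ v v).re = ‖v‖ ^ 2 := inner_self_eq_norm_sq (𝕜 := ℂ)
  rw [← hnorm, ← hnorm]
  simp only [inner_sub_left, inner_sub_right, inner_smul_left, inner_smul_right,
    Complex.conj_ofReal, Complex.sub_re, Complex.re_ofReal_mul, ← hB.isSymmetric.apply_clm u u] at h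
  linarith

/-- The number of eigenvalues of `B` in `S`, counted according to their multiplicities, as it
occurs in `SpectrumConsistsOf`. It is meaningful when the spectrum of `B` in `S` is finite and
consists of eigenvalues of finite multiplicity; otherwise `finsum` and `finrank` may give `0`. -/
def eigenvalueCount (B : G →L[ℂ] G) (S : Set ℝ) : ℕ :=
  ∑ᶠ t ∈ realSpectrum B ∩ S, finrank ℂ (eigenspace B.toLinearMap (t : ℂ))

section FiniteCodimension

variable {W : Type*} [NormedAddCommGroup W] [NormedSpace ℂ W] {φ : G →L[ℂ] W} {r : ℝ}

theorem injective_comp_of_norm_map_lt {L : Type*} [AddCommGroup L] [Module ℂ L]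
    (hφ : ∀ u ∈ φ.ker, r * ‖u‖ ≤ ‖B u‖) (f : L →ₗ[ℂ] G)
    (hf : ∀ x ≠ 0, ‖B (f x)‖ < r * ‖f x‖) : Function.Injective (φ.toLinearMap ∘ₗ f) := by
  rw [← LinearMap.ker_eq_bot, LinearMap.ker_eq_bot']
  intro x hx
  by_contra hne
  exact (hf x hne).not_ge (hφ _ hx)

variable [FiniteDimensional ℂ W]

theorem finiteDimensional_eigenspace (hφ : ∀ u ∈ φ.ker, r * ‖u‖ ≤ ‖B u‖) {t : ℝ}
    (ht : |t| < r) : FiniteDimensional ℂ (eigenspace B.toLinearMap (t : ℂ)) :=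
  .of_injective _ <| injective_comp_of_norm_map_lt hφ (Submodule.subtype _) fun x hx =>
    (norm_map_of_mem_eigenspace x.2).trans_lt
      (mul_lt_mul_of_pos_right ht (norm_pos_iff.2 (by simpa using hx)))

theorem sum_finrank_eigenspace_le (hB : (B : G →ₗ[ℂ] G).IsSymmetric)
    (hφ : ∀ u ∈ φ.ker, r * ‖u‖ ≤ ‖B u‖) {s : Finset ℝ} (hs : ∀ t ∈ s, |t| < r) :
    ∑ t ∈ s, finrank ℂ (eigenspace B.toLinearMap (t : ℂ)) ≤ finrank ℂ W := by
  have : ∀ t : s, FiniteDimensional ℂ (eigenspace B.toLinearMap ((t : ℝ) : ℂ)) :=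
    fun t => finiteDimensional_eigenspace hφ (hs t t.2)
  rw [← Finset.sum_coe_sort s, ← finrank_pi_fintype]
  let sumMap : (∀ t : s, eigenspace B.toLinearMap ((t : ℝ) : ℂ)) →ₗ[ℂ] G :=
    ∑ t : s, (eigenspace B.toLinearMap ((t : ℝ) : ℂ)).subtype ∘ₗ LinearMap.proj t
  refine LinearMap.finrank_le_finrank_of_injective
    (injective_comp_of_norm_map_lt hφ sumMap fun x hx => ?_)
  simpa [sumMap] using norm_map_sum_eigenvectors_lt hB hs hx

variable [CompleteSpace G]

theorem hasEigenvalue_of_mem_realSpectrum (hB : IsSelfAdjoint B)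
    (hφ : ∀ u ∈ φ.ker, r * ‖u‖ ≤ ‖B u‖) {t : ℝ} (ht : |t| < r) (hs : t ∈ realSpectrum B) :
    HasEigenvalue B.toLinearMap (t : ℂ) := by
  by_contra hne
  let T : G →L[ℂ] G := algebraMap ℂ (G →L[ℂ] G) t - B
  have hTa : ∀ u, T u = (t : ℂ) • u - B u := fun u => by
    simp [T, Algebra.algebraMap_eq_smul_one]
  have hT : IsSelfAdjoint T := by
    refine .sub ?_ hB
    rw [Algebra.algebraMap_eq_smul_one]
    exact .smul (Complex.conj_ofReal t) (.one _)
  have hker : T.ker = ⊥ := by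
    rw [← not_ne_iff.1 hne]
    ext u
    rw [LinearMap.mem_ker, ContinuousLinearMap.coe_coe, hTa, sub_eq_zero, mem_eigenspace_iff,
      eq_comm, ContinuousLinearMap.coe_coe]
  have hrange : IsClosed (T.range : Set G) := by
    refine isClosed_range_of_bound_on_ker T φ (sub_pos.2 ht) fun u hu => ?_
    have h := norm_sub_norm_le (B u) ((t : ℂ) • u)
    rw [norm_smul, Complex.norm_real, Real.norm_eq_abs, norm_sub_rev, ← hTa] at h
    linarith [hφ u hu]
  exact hs (isUnit_of_ker_eq_bot_of_isClosed_range hT hker hrange)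

theorem finite_realSpectrum_inter (hB : IsSelfAdjoint B) (hφ : ∀ u ∈ φ.ker, r * ‖u‖ ≤ ‖B u‖)
    {S : Set ℝ} (hS : ∀ t ∈ S, |t| < r) : (realSpectrum B ∩ S).Finite := by
  by_contra hinf
  obtain ⟨s, hs, hcard⟩ := Set.Infinite.exists_subset_card_eq hinf (finrank ℂ W + 1)
  have hle := sum_finrank_eigenspace_le hB.isSymmetric hφ fun t ht => hS t (hs ht).2
  have hone : ∑ t ∈ s, 1 ≤ ∑ t ∈ s, finrank ℂ (eigenspace B.toLinearMap (t : ℂ)) := by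
    refine Finset.sum_le_sum fun t ht => ?_
    have := finiteDimensional_eigenspace hφ (hS t (hs ht).2)
    exact Submodule.one_le_finrank_iff.2
      (hasEigenvalue_of_mem_realSpectrum hB hφ (hS t (hs ht).2) (hs ht).1)
  rw [Finset.sum_const, smul_eq_mul, mul_one] at hone
  omega

theorem spectrumConsistsOf_eigenvalueCount (hB : IsSelfAdjoint B)
    (hφ : ∀ u ∈ φ.ker, r * ‖u‖ ≤ ‖B u‖) {S : Set ℝ} (hS : ∀ t ∈ S, |t| < r) :
    SpectrumConsistsOf B S (eigenvalueCount B S) :=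
  ⟨finite_realSpectrum_inter hB hφ hS, fun t ht =>
    ⟨hasEigenvalue_of_mem_realSpectrum hB hφ (hS t ht.2) ht.1,
      finiteDimensional_eigenspace hφ (hS t ht.2)⟩, rfl⟩

theorem eigenvalueCount_le_finrank (hB : IsSelfAdjoint B) (hφ : ∀ u ∈ φ.ker, r * ‖u‖ ≤ ‖B u‖)
    {S : Set ℝ} (hS : ∀ t ∈ S, |t| < r) : eigenvalueCount B S ≤ finrank ℂ W := by
  have hfin := finite_realSpectrum_inter hB hφ hS
  rw [eigenvalueCount, finsum_mem_eq_finite_toFinset_sum _ hfin]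
  exact sum_finrank_eigenspace_le hB.isSymmetric hφ fun t ht => hS t (hfin.mem_toFinset.1 ht).2

theorem eigenvalueCount_union (hB : IsSelfAdjoint B) (hφ : ∀ u ∈ φ.ker, r * ‖u‖ ≤ ‖B u‖)
    {S T : Set ℝ} (hS : ∀ t ∈ S, |t| < r) (hT : ∀ t ∈ T, |t| < r) (hST : Disjoint S T) :
    eigenvalueCount B (S ∪ T) = eigenvalueCount B S + eigenvalueCount B T := by
  rw [eigenvalueCount, Set.inter_union_distrib_left]
  exact finsum_mem_union (hST.mono Set.inter_subset_right Set.inter_subset_right)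
    (finite_realSpectrum_inter hB hφ hS) (finite_realSpectrum_inter hB hφ hT)

theorem add_mul_re_inner_le_of_mem_orthogonal (hB : IsSelfAdjoint B)
    (hφ : ∀ u ∈ φ.ker, r * ‖u‖ ≤ ‖B u‖) {a b : ℝ} (hab : a ≤ b)
    (habr : ∀ t ∈ Set.Ioo a b, |t| < r) {u : G}
    (hu : ∀ t ∈ Set.Ioo a b, u ∈ (eigenspace B.toLinearMap (t : ℂ))ᗮ) :
    (a + b) * (inner ℂ (B u) u).re ≤ ‖B u‖ ^ 2 + a * b * ‖u‖ ^ 2 := by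
  let F : Submodule ℂ G := ⨅ t ∈ Set.Ioo a b, (eigenspace B.toLinearMap (t : ℂ))ᗮ
  have hF : ∀ {v}, v ∈ F ↔ ∀ t ∈ Set.Ioo a b, v ∈ (eigenspace B.toLinearMap (t : ℂ))ᗮ := by
    simp only [F, Submodule.mem_iInf, implies_true]
  have hBF : ∀ v : F, B v ∈ F := fun v => hF.2 fun t ht w hw => by
    rw [← hB.isSymmetric.apply_clm, show B w = (t : ℂ) • w from mem_eigenspace_iff.1 hw,
      inner_smul_left, hF.1 v.2 t ht w hw, mul_zero]
  have : CompleteSpace F := by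
    have hclosed : IsClosed (F : Set G) := by
      simp only [F, Submodule.coe_iInf]
      exact isClosed_biInter fun t _ => Submodule.isClosed_orthogonal _
    exact hclosed.completeSpace_coe
  let BF : F →L[ℂ] F := (B ∘L F.subtypeL).codRestrict F hBF
  have hBF' : IsSelfAdjoint BF :=
    ContinuousLinearMap.isSelfAdjoint_iff_isSymmetric.2 fun v w => hB.isSymmetric v w
  refine add_mul_re_inner_le_of_spectral_gap hBF' hab (Set.disjoint_right.2 fun t ht hspec => ?_)
    ⟨u, hF.2 hu⟩
  obtain ⟨w, hw⟩ := (hasEigenvalue_of_mem_realSpectrum (φ := φ ∘L F.subtypeL) hBF'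
    (fun v hv => hφ v hv) (habr t ht) hspec).exists_hasEigenvector
  have hwt : (w : G) ∈ eigenspace B.toLinearMap (t : ℂ) :=
    mem_eigenspace_iff.2 (congrArg Subtype.val hw.apply_eq_smul)
  exact hw.2 (Subtype.ext (inner_self_eq_zero.1 (hF.1 w.2 t ht w hwt)))

theorem finrank_le_eigenvalueCount {L : Type*} [AddCommGroup L] [Module ℂ L]
    (hB : IsSelfAdjoint B) (hφ : ∀ u ∈ φ.ker, r * ‖u‖ ≤ ‖B u‖) {a b : ℝ} (hab : a ≤ b)
    (habr : ∀ t ∈ Set.Ioo a b, |t| < r) (f : L →ₗ[ℂ] G)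
    (hf : ∀ x ≠ 0, ‖B (f x)‖ ^ 2 + a * b * ‖f x‖ ^ 2 < (a + b) * (inner ℂ (B (f x)) (f x)).re) :
    finrank ℂ L ≤ eigenvalueCount B (Set.Ioo a b) := by
  have hfin := finite_realSpectrum_inter hB hφ habr
  have : ∀ t : hfin.toFinset, FiniteDimensional ℂ (eigenspace B.toLinearMap ((t : ℝ) : ℂ)) :=
    fun t => finiteDimensional_eigenspace hφ (habr t (hfin.mem_toFinset.1 t.2).2)
  rw [eigenvalueCount, finsum_mem_eq_finite_toFinset_sum _ hfin, ← Finset.sum_coe_sort,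
    ← finrank_pi_fintype]
  let proj : L →ₗ[ℂ] (∀ t : hfin.toFinset, eigenspace B.toLinearMap ((t : ℝ) : ℂ)) :=
    LinearMap.pi fun t =>
      (eigenspace B.toLinearMap ((t : ℝ) : ℂ)).orthogonalProjectionOnto.toLinearMap ∘ₗ f
  refine LinearMap.finrank_le_finrank_of_injective (f := proj) ?_
  rw [← LinearMap.ker_eq_bot, LinearMap.ker_eq_bot']
  intro x hx
  by_contra hne
  refine (hf x hne).not_ge
    (add_mul_re_inner_le_of_mem_orthogonal hB hφ hab habr fun t ht => ?_)
  by_cases hev : HasEigenvalue B.toLinearMap (t : ℂ)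
  · have hmem : t ∈ hfin.toFinset :=
      hfin.mem_toFinset.2 ⟨mem_realSpectrum_of_hasEigenvalue hev, ht⟩
    have := finiteDimensional_eigenspace hφ (habr t ht)
    exact Submodule.orthogonalProjectionOnto_eq_zero_iff.1 (congrFun hx ⟨t, hmem⟩)
  · simp [not_ne_iff.1 hev]

theorem eigenvalueCount_neg_add_zero_add_pos_le (hB : IsSelfAdjoint B)
    (hφ : ∀ u ∈ φ.ker, r * ‖u‖ ≤ ‖B u‖) {ε : ℝ} (hε : 0 < ε) (hεr : ε < r) :
    eigenvalueCount B (Set.Ioo (-ε) 0) + eigenvalueCount B {0} + eigenvalueCount B (Set.Ioo 0 ε) ≤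
      finrank ℂ W := by
  have habs : ∀ t ∈ Set.Ioo (-ε) ε, |t| < r := fun t ht => (abs_lt.2 ht).trans hεr
  have hnonpos : Set.Ioo (-ε) 0 ∪ {0} ⊆ Set.Ioo (-ε) ε := by
    rintro t (ht | rfl)
    exacts [⟨ht.1, ht.2.trans hε⟩, ⟨neg_lt_zero.2 hε, hε⟩]
  have hpos : Set.Ioo 0 ε ⊆ Set.Ioo (-ε) ε := Set.Ioo_subset_Ioo_left (neg_lt_zero.2 hε).le
  have hdisj : Disjoint (Set.Ioo (-ε) 0 ∪ {0}) (Set.Ioo 0 ε) :=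
    Set.disjoint_left.2 fun t ht ht' =>
      ht.elim (fun h => lt_asymm h.2 ht'.1) fun h => ht'.1.ne' h
  rw [← eigenvalueCount_union hB hφ (fun t ht => habs t (hnonpos (.inl ht)))
      (fun t ht => habs t (hnonpos (.inr ht))) (by simp),
    ← eigenvalueCount_union hB hφ (fun t ht => habs t (hnonpos ht))
      (fun t ht => habs t (hpos ht)) hdisj]
  exact eigenvalueCount_le_finrank hB hφ fun t ht => habs t (Set.union_subset hnonpos hpos ht)

/-- The bound on `ker φ` gives at most `dim W` eigenvalues in `(-ε, ε)`, the test spaces give at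
least `dim L₁` negative and `dim L₂` positive ones. -/
theorem spectrumConsistsOf_of_test_spaces {L₁ L₂ : Type*} [AddCommGroup L₁] [Module ℂ L₁]
    [AddCommGroup L₂] [Module ℂ L₂] (hB : IsSelfAdjoint B)
    (hφ : ∀ u ∈ φ.ker, r * ‖u‖ ≤ ‖B u‖) {ε : ℝ} (hε : 0 < ε) (hεr : ε < r)
    (hW : finrank ℂ W ≤ finrank ℂ L₁ + finrank ℂ L₂)
    (f₁ : L₁ →ₗ[ℂ] G) (hf₁ : ∀ x ≠ 0, ‖B (f₁ x)‖ ^ 2 < ε * -(inner ℂ (B (f₁ x)) (f₁ x)).re)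
    (f₂ : L₂ →ₗ[ℂ] G) (hf₂ : ∀ x ≠ 0, ‖B (f₂ x)‖ ^ 2 < ε * (inner ℂ (B (f₂ x)) (f₂ x)).re) :
    SpectrumConsistsOf B (Set.Ioo (-ε) 0) (finrank ℂ L₁) ∧ 0 ∉ realSpectrum B ∧
      SpectrumConsistsOf B (Set.Ioo 0 ε) (finrank ℂ L₂) := by
  have hneg : ∀ t ∈ Set.Ioo (-ε) 0, |t| < r := fun t ht =>
    abs_lt.2 ⟨by linarith [ht.1], by linarith [ht.2]⟩
  have hpos : ∀ t ∈ Set.Ioo 0 ε, |t| < r := fun t ht =>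
    abs_lt.2 ⟨by linarith [ht.1], by linarith [ht.2]⟩
  have hr : |(0 : ℝ)| < r := by simpa using hε.trans hεr
  have hcount₁ : finrank ℂ L₁ ≤ eigenvalueCount B (Set.Ioo (-ε) 0) :=
    finrank_le_eigenvalueCount hB hφ (neg_lt_zero.2 hε).le hneg f₁ fun x hx => by
      simpa using hf₁ x hx
  have hcount₂ : finrank ℂ L₂ ≤ eigenvalueCount B (Set.Ioo 0 ε) :=
    finrank_le_eigenvalueCount hB hφ hε.le hpos f₂ fun x hx => by simpa using hf₂ x hx
  have hcount := eigenvalueCount_neg_add_zero_add_pos_le hB hφ hε hεr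
  have heq₁ : finrank ℂ L₁ = eigenvalueCount B (Set.Ioo (-ε) 0) := by omega
  have heq₂ : finrank ℂ L₂ = eigenvalueCount B (Set.Ioo 0 ε) := by omega
  refine ⟨heq₁ ▸ spectrumConsistsOf_eigenvalueCount hB hφ hneg, fun hmem => ?_,
    heq₂ ▸ spectrumConsistsOf_eigenvalueCount hB hφ hpos⟩
  have := finiteDimensional_eigenspace hφ hr
  have hone : 1 ≤ eigenvalueCount B {0} := by
    rw [eigenvalueCount, Set.inter_eq_right.2 (Set.singleton_subset_iff.2 hmem),
      finsum_mem_singleton]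
    exact Submodule.one_le_finrank_iff.2 (hasEigenvalue_of_mem_realSpectrum hB hφ hr hmem)
  omega

end FiniteCodimension

theorem spectrumConsistsOf_finrank_ker [CompleteSpace G] [FiniteDimensional ℂ B.ker]
    (hB : IsSelfAdjoint B) {r ε : ℝ} (hr : ∀ u ∈ B.kerᗮ, r * ‖u‖ ≤ ‖B u‖) (hε : 0 < ε)
    (hεr : ε < r) : realSpectrum B ∩ Set.Ioo (-ε) ε ⊆ {0} ∧
      SpectrumConsistsOf B (Set.Ioo (-ε) ε) (finrank ℂ B.ker) := by
  have hφ : ∀ u ∈ B.ker.orthogonalProjectionOnto.ker, r * ‖u‖ ≤ ‖B u‖ := fun u hu =>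
    hr u (Submodule.orthogonalProjectionOnto_eq_zero_iff.1 hu)
  have habs : ∀ t ∈ Set.Ioo (-ε) ε, |t| < r := fun t ht => (abs_lt.2 ht).trans hεr
  have hsub : realSpectrum B ∩ Set.Ioo (-ε) ε ⊆ {0} := by
    rintro t ⟨ht, htε⟩
    by_contra hne
    obtain ⟨w, hw⟩ :=
      (hasEigenvalue_of_mem_realSpectrum hB hφ (habs t htε) ht).exists_hasEigenvector
    have hort : w ∈ B.kerᗮ := fun v hv => by
      have h := hB.isSymmetric.apply_clm v w
      rw [show B v = 0 from hv, show B w = (t : ℂ) • w from hw.apply_eq_smul, inner_zero_left,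
        inner_smul_right] at h
      exact (mul_eq_zero.1 h.symm).resolve_left (Complex.ofReal_ne_zero.2 hne)
    have h := hr w hort
    rw [norm_map_of_mem_eigenspace hw.1] at h
    exact (habs t htε).not_ge (le_of_mul_le_mul_right h (norm_pos_iff.2 hw.2))
  refine ⟨hsub, ?_⟩
  convert spectrumConsistsOf_eigenvalueCount hB hφ habs
  have hker : eigenspace B.toLinearMap ((0 : ℝ) : ℂ) = B.ker := by
    rw [Complex.ofReal_zero, eigenspace_zero]
  rw [eigenvalueCount, finsum_mem_inter_support_eq _ _ {0} ?_, finsum_mem_singleton, hker]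
  refine Set.Subset.antisymm (Set.inter_subset_inter_left _ hsub) ?_
  rintro t ⟨rfl, ht⟩
  refine ⟨⟨mem_realSpectrum_of_hasEigenvalue fun h => ht ?_, neg_lt_zero.2 hε, hε⟩, ht⟩
  exact (congrArg (fun E : Submodule ℂ G => finrank ℂ E) h).trans (finrank_bot ℂ G)

end SpectralCounting

section Orthogonality

variable {𝕜 V : Type*} [RCLike 𝕜] [NormedAddCommGroup V] [InnerProductSpace 𝕜 V]

theorem norm_le_norm_sub_of_mem_orthogonal {X : Submodule 𝕜 V} {x y : V} (hx : x ∈ Xᗮ)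
    (hy : y ∈ X) : ‖x‖ ≤ ‖x - y‖ := by
  have h := norm_sub_sq (𝕜 := 𝕜) x y
  rw [X.inner_left_of_mem_orthogonal hy hx, map_zero] at h
  exact le_of_sq_le_sq (by nlinarith [sq_nonneg ‖y‖]) (norm_nonneg _)

theorem starProjection_orthogonal_inf_apply {C X : Submodule 𝕜 V} [X.HasOrthogonalProjection]
    [(Cᗮ ⊓ X).HasOrthogonalProjection] (hCX : C ≤ X) {y : V} (hy : y ∈ Cᗮ) :
    (Cᗮ ⊓ X).starProjection y = X.starProjection y := by
  refine Submodule.eq_starProjection_of_mem_orthogonal ⟨fun c hc => ?_, ?_⟩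
    (Submodule.orthogonal_le inf_le_right (X.sub_starProjection_mem_orthogonal y))
  · rw [← X.inner_starProjection_left_eq_right, X.starProjection_eq_self_iff.2 (hCX hc)]
    exact hy c hc
  · exact X.starProjection_apply_mem y

end Orthogonality

noncomputable section Compression

variable {𝕜 V : Type*} [RCLike 𝕜] [NormedAddCommGroup V] [InnerProductSpace 𝕜 V]

/-- The weak solutions `u` of `T u = 0` tested on `U`, that is, of `⟪T v, u⟫ = 0` for all `v ∈ U`.
For `T = 1 - μ A_N⁻¹` on `H¹` and `U = H₀¹` this is the space `G_μ`. -/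
def weakKer (T : V →L[𝕜] V) (U : Submodule 𝕜 V) : Submodule 𝕜 V := (U.map T.toLinearMap)ᗮ

/-- The kernel of the compression of a symmetric operator `T` to `U`. -/
def compressedKer (T : V →L[𝕜] V) (U : Submodule 𝕜 V) : Submodule 𝕜 V := U ⊓ weakKer T U

/-- The part of the kernel of `T` that lies in `U`. -/
def commonKer (T : V →L[𝕜] V) (U : Submodule 𝕜 V) : Submodule 𝕜 V := U ⊓ T.ker

variable {T S : V →L[𝕜] V} {U C : Submodule 𝕜 V}

theorem mem_weakKer {u : V} : u ∈ weakKer T U ↔ ∀ v ∈ U, inner 𝕜 (T v) u = 0 :=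
  Submodule.mem_orthogonal _ _ |>.trans Set.forall_mem_image

instance [CompleteSpace V] : CompleteSpace (weakKer T U) :=
  (Submodule.isClosed_orthogonal _).completeSpace_coe

theorem ker_le_weakKer (hT : (T : V →ₗ[𝕜] V).IsSymmetric) : T.ker ≤ weakKer T U :=
  fun u hu => mem_weakKer.2 fun v _ => by
    rw [hT.apply_clm, show T u = 0 from hu, inner_zero_right]

theorem commonKer_eq_ker_inf_compressedKer (hT : (T : V →ₗ[𝕜] V).IsSymmetric) :
    commonKer T U = T.ker ⊓ compressedKer T U := by
  rw [commonKer, compressedKer, inf_left_comm, inf_eq_left.2 (ker_le_weakKer hT)]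

theorem commonKer_le_ker : commonKer T U ≤ T.ker :=
  inf_le_right

theorem commonKer_le_compressedKer (hT : (T : V →ₗ[𝕜] V).IsSymmetric) :
    commonKer T U ≤ compressedKer T U :=
  (commonKer_eq_ker_inf_compressedKer hT).le.trans inf_le_right

theorem ker_sup_compressedKer_le_weakKer (hT : (T : V →ₗ[𝕜] V).IsSymmetric) :
    T.ker ⊔ compressedKer T U ≤ weakKer T U :=
  sup_le (ker_le_weakKer hT) inf_le_right

theorem starProjection_map_eq_zero_of_mem_weakKer (hT : (T : V →ₗ[𝕜] V).IsSymmetric)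
    [U.HasOrthogonalProjection] {u : V} (hu : u ∈ weakKer T U) : U.starProjection (T u) = 0 := by
  refine (U.starProjection_apply_eq_zero_iff).2 fun v hv => ?_
  rw [← hT.apply_clm]
  exact mem_weakKer.1 hu v hv

section SplitOff

variable [C.HasOrthogonalProjection] (hCU : C ≤ U)
include hCU

theorem weakKer_eq_inf_weakKer_orthogonal_inf :
    weakKer T U = (C.map T.toLinearMap)ᗮ ⊓ weakKer T (Cᗮ ⊓ U) := by
  rw [weakKer, weakKer, Submodule.inf_orthogonal, ← Submodule.map_sup,
    Submodule.sup_orthogonal_inf_of_hasOrthogonalProjection hCU]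

theorem weakKer_eq_weakKer_orthogonal_inf (hCT : C ≤ T.ker) :
    weakKer T U = weakKer T (Cᗮ ⊓ U) := by
  rw [weakKer_eq_inf_weakKer_orthogonal_inf hCU, LinearMap.le_ker_iff_map.1 hCT,
    Submodule.bot_orthogonal_eq_top, top_inf_eq]

end SplitOff

variable [CompleteSpace V]

theorem starProjection_weakKer_map_eq_zero {u : V} (hu : u ∈ U) :
    (weakKer T U).starProjection (T u) = 0 :=
  (Submodule.starProjection_apply_eq_zero_iff _).2 <|
    Submodule.le_orthogonal_orthogonal _ (Submodule.mem_map_of_mem hu)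

variable (T U) in
/-- The compression of `T` to its weak solutions, extended by zero to the orthogonal complement.
For `T = 1 - μ A_N⁻¹` on `H¹` and `U = H₀¹` it restricts to `𝓑_μ` on `G_μ`. -/
def compress : V →L[𝕜] V :=
  (weakKer T U).starProjection ∘L T ∘L (weakKer T U).starProjection

theorem compress_apply (u : V) : compress T U u =
    (weakKer T U).starProjection (T ((weakKer T U).starProjection u)) :=
  rfl

theorem compress_apply_of_mem {u : V} (hu : u ∈ weakKer T U) :
    compress T U u = (weakKer T U).starProjection (T u) := by
  rw [compress_apply, Submodule.starProjection_eq_self_iff.2 hu]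

theorem inner_compress_self (u : V) : inner 𝕜 (compress T U u) u =
    inner 𝕜 (T ((weakKer T U).starProjection u)) ((weakKer T U).starProjection u) := by
  rw [compress_apply, Submodule.inner_starProjection_left_eq_right]

theorem compress_apply_of_mem_orthogonal [C.HasOrthogonalProjection]
    (hT : (T : V →ₗ[𝕜] V).IsSymmetric) (hCU : C ≤ U) (hCT : C.map T.toLinearMap = C) {u : V}
    (hu : u ∈ Cᗮ) : compress T U u = compress T (Cᗮ ⊓ U) u := by
  have hmap : ∀ v ∈ Cᗮ, T v ∈ Cᗮ := fun v hv c hc => by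
    rw [← hT.apply_clm]
    exact hv _ (hCT ▸ Submodule.mem_map_of_mem hc)
  have hweak : weakKer T U = Cᗮ ⊓ weakKer T (Cᗮ ⊓ U) := by
    rw [weakKer_eq_inf_weakKer_orthogonal_inf hCU, hCT]
  have hC : C ≤ weakKer T (Cᗮ ⊓ U) := fun c hc =>
    mem_weakKer.2 fun v hv => C.inner_left_of_mem_orthogonal hc (hmap v hv.1)
  have hproj : ∀ v ∈ Cᗮ, (weakKer T U).starProjection v =
      (weakKer T (Cᗮ ⊓ U)).starProjection v := fun v hv => by
    have : (Cᗮ ⊓ weakKer T (Cᗮ ⊓ U)).HasOrthogonalProjection := hweak ▸ inferInstance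
    rw [← starProjection_orthogonal_inf_apply hC hv]
    congr!
  have hproj_mem : (weakKer T (Cᗮ ⊓ U)).starProjection u ∈ Cᗮ := by
    rw [← hproj u hu]
    exact (hweak.le (Submodule.starProjection_apply_mem _ u)).1
  rw [compress_apply, hproj u hu, hproj _ (hmap _ hproj_mem), compress_apply]

/-- The component of `T u` orthogonal to the weak solutions is `T v` for some `v ∈ U`; then
`T (u - v)` and the compression of `T v` to `U` are controlled by the remaining component. -/
theorem exists_norm_sub_le_norm_compress (hT : (T : V →ₗ[𝕜] V).IsSymmetric)
    [U.HasOrthogonalProjection] (hTU : IsClosed (U.map T.toLinearMap : Set V)) {c : ℝ}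
    (hc : 0 ≤ c) (hker : ∀ v, ∃ n ∈ T.ker, c * ‖v - n‖ ≤ ‖T v‖)
    (hcompr : ∀ v ∈ U, ∃ d ∈ compressedKer T U, c * ‖v - d‖ ≤ ‖U.starProjection (T v)‖)
    {u : V} (hu : u ∈ weakKer T U) :
    ∃ w ∈ T.ker ⊔ compressedKer T U, c / 2 * ‖u - w‖ ≤ ‖compress T U u‖ := by
  obtain ⟨v, hvU, hv⟩ : T u - compress T U u ∈ U.map T.toLinearMap := by
    rw [compress_apply_of_mem hu, ← hTU.submodule_topologicalClosure_eq,
      ← Submodule.orthogonal_orthogonal_eq_closure]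
    exact Submodule.sub_starProjection_mem_orthogonal _
  have hvT : T v = T u - compress T U u := hv
  obtain ⟨n, hn, hun⟩ := hker (u - v)
  obtain ⟨d, hd, hvd⟩ := hcompr v hvU
  refine ⟨n + d, add_mem (Submodule.mem_sup_left hn) (Submodule.mem_sup_right hd), ?_⟩
  rw [map_sub, hvT, sub_sub_cancel] at hun
  rw [hvT, map_sub, starProjection_map_eq_zero_of_mem_weakKer hT hu, zero_sub, norm_neg] at hvd
  have hproj := U.norm_starProjection_apply_le (compress T U u)
  have htri : ‖u - (n + d)‖ ≤ ‖u - v - n‖ + ‖v - d‖ := by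
    rw [show u - (n + d) = u - v - n + (v - d) by abel]
    exact norm_add_le _ _
  nlinarith [mul_le_mul_of_nonneg_left htri hc]

theorem compress_eq_zero_of_mem {m : V} (hT : (T : V →ₗ[𝕜] V).IsSymmetric)
    (hm : m ∈ T.ker ⊔ compressedKer T U) : compress T U m = 0 := by
  rw [compress_apply_of_mem (ker_sup_compressedKer_le_weakKer hT hm)]
  obtain ⟨n, hn, d, hd, rfl⟩ := Submodule.mem_sup.1 hm
  rw [map_add, show T n = 0 from hn, zero_add, starProjection_weakKer_map_eq_zero hd.1]

end Compression

section Perturbation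

variable {𝕜 V : Type*} [RCLike 𝕜] [NormedAddCommGroup V] [InnerProductSpace 𝕜 V]
  {S T : V →L[𝕜] V} {U : Submodule 𝕜 V} {c : ℝ}

theorem half_mul_norm_le_of_norm_sub_le (hS : ∀ u ∈ U, c * ‖u‖ ≤ ‖S u‖)
    (hTS : ‖T - S‖ ≤ c / 2) {u : V} (hu : u ∈ U) : c / 2 * ‖u‖ ≤ ‖T u‖ := by
  have hsub : ‖(T - S) u‖ ≤ c / 2 * ‖u‖ := (T - S).le_of_opNorm_le hTS u
  have htri : ‖S u‖ ≤ ‖T u‖ + ‖(T - S) u‖ := by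
    rw [sub_apply, norm_sub_rev]
    exact norm_le_norm_add_norm_sub' _ _
  linarith [hS u hu]

theorem abs_re_inner_map_le_of_norm_le (T : V →L[𝕜] V) {w : V} {b : ℝ} (hw : ‖w‖ ≤ b) :
    |RCLike.re (inner 𝕜 (T w) w)| ≤ ‖T‖ * b ^ 2 := by
  have hb : 0 ≤ b := (norm_nonneg w).trans hw
  calc |RCLike.re (inner 𝕜 (T w) w)| ≤ ‖T w‖ * ‖w‖ :=
        (RCLike.abs_re_le_norm _).trans (norm_inner_le_norm _ _)
    _ ≤ ‖T‖ * b * b := mul_le_mul (T.le_opNorm_of_le hw) hw (norm_nonneg w) (by positivity)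
    _ = ‖T‖ * b ^ 2 := by ring

variable [CompleteSpace V]

theorem norm_sub_starProjection_weakKer_le (hU : IsClosed (U : Set V)) (hc : 0 < c)
    (hS : ∀ u ∈ U, c * ‖u‖ ≤ ‖S u‖) {g : V} (hg : g ∈ weakKer T U) :
    ‖g - (weakKer S U).starProjection g‖ ≤ ‖T - S‖ / c * ‖g‖ := by
  set h := g - (weakKer S U).starProjection g with h_def
  have hmem : h ∈ (weakKer S U)ᗮ := Submodule.sub_starProjection_mem_orthogonal g
  obtain ⟨v, hvU, hv⟩ : h ∈ U.map S.toLinearMap := by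
    rwa [weakKer, Submodule.orthogonal_orthogonal_eq_closure,
      (isClosed_map_of_bound S hU hc hS).submodule_topologicalClosure_eq] at hmem
  have hSv : S v = h := hv
  have hinner : inner 𝕜 h h = inner 𝕜 ((S - T) v) g := by
    rw [sub_apply, inner_sub_left (S v), mem_weakKer.1 hg v hvU, sub_zero, hSv, ← sub_eq_zero,
      ← inner_sub_right, h_def, sub_sub_cancel_left, inner_neg_right, neg_eq_zero]
    exact Submodule.inner_left_of_mem_orthogonal (Submodule.starProjection_apply_mem _ g)
      (Submodule.sub_starProjection_mem_orthogonal g)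
  have hsq : ‖h‖ ^ 2 ≤ ‖T - S‖ * ‖v‖ * ‖g‖ := by
    rw [← inner_self_eq_norm_sq (𝕜 := 𝕜), hinner, norm_sub_rev T S]
    exact (RCLike.re_le_norm _).trans <| (norm_inner_le_norm _ _).trans <|
      mul_le_mul_of_nonneg_right ((S - T).le_opNorm v) (norm_nonneg g)
  have hvh : c * ‖v‖ ≤ ‖h‖ := hSv ▸ hS v hvU
  rw [div_mul_eq_mul_div, le_div_iff₀ hc]
  rcases (norm_nonneg h).eq_or_lt with h0 | h0
  · rw [← h0, zero_mul]
    positivity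
  · refine le_of_mul_le_mul_right ?_ h0
    have hTg : 0 ≤ ‖T - S‖ * ‖g‖ := by positivity
    nlinarith [mul_le_mul_of_nonneg_left hvh hTg]

theorem norm_starProjection_weakKer_sub_le (hU : IsClosed (U : Set V)) (hc : 0 < c)
    (hS : ∀ u ∈ U, c * ‖u‖ ≤ ‖S u‖) (hT : ∀ u ∈ U, c * ‖u‖ ≤ ‖T u‖) :
    ‖(weakKer T U).starProjection - (weakKer S U).starProjection‖ ≤ 2 * (‖T - S‖ / c) := by
  have gap : ∀ {S T : V →L[𝕜] V}, (∀ u ∈ U, c * ‖u‖ ≤ ‖S u‖) →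
      ‖(1 - (weakKer S U).starProjection) * (weakKer T U).starProjection‖ ≤ ‖T - S‖ / c := by
    intro S T hS
    refine ContinuousLinearMap.opNorm_le_bound _ (by positivity) fun x => ?_
    refine (norm_sub_starProjection_weakKer_le hU hc hS
      (Submodule.starProjection_apply_mem _ x)).trans ?_
    gcongr
    exact Submodule.norm_starProjection_apply_le _ x
  set P := (weakKer T U).starProjection
  set Q := (weakKer S U).starProjection
  have hstar : ‖Q * (1 - P)‖ = ‖(1 - P) * Q‖ := by
    rw [← norm_star (Q * (1 - P)), star_mul, star_sub, star_one,
      (isSelfAdjoint_starProjection _).star_eq, (isSelfAdjoint_starProjection _).star_eq]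
  calc ‖P - Q‖ = ‖(1 - Q) * P - Q * (1 - P)‖ := by congr 1; noncomm_ring
    _ ≤ ‖(1 - Q) * P‖ + ‖(1 - P) * Q‖ := hstar ▸ norm_sub_le _ _
    _ ≤ 2 * (‖T - S‖ / c) := by
      rw [two_mul]
      exact add_le_add (gap hS) (norm_sub_rev S T ▸ gap hT)

theorem continuousAt_starProjection_weakKer (hU : IsClosed (U : Set V)) (hc : 0 < c)
    (hS : ∀ u ∈ U, c * ‖u‖ ≤ ‖S u‖) :
    ContinuousAt (fun T : V →L[𝕜] V => (weakKer T U).starProjection) S := by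
  have hc' : 0 < c / 2 := half_pos hc
  have hlim : Tendsto (fun T : V →L[𝕜] V => ‖T - S‖) (𝓝 S) (𝓝 0) :=
    tendsto_iff_norm_sub_tendsto_zero.1 tendsto_id
  refine tendsto_iff_norm_sub_tendsto_zero.2 <| squeeze_zero' (.of_forall fun _ => norm_nonneg _)
    ?_ (by simpa using (hlim.div_const (c / 2)).const_mul 2)
  filter_upwards [hlim.eventually_le_const hc'] with T hTS
  exact norm_starProjection_weakKer_sub_le hU hc'
    (fun u hu => half_mul_norm_le_of_norm_sub_le hS (by simpa using hc'.le) hu)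
    fun u hu => half_mul_norm_le_of_norm_sub_le hS hTS hu

theorem continuousAt_compress (hU : IsClosed (U : Set V)) (hc : 0 < c)
    (hS : ∀ u ∈ U, c * ‖u‖ ≤ ‖S u‖) :
    ContinuousAt (fun T : V →L[𝕜] V => compress T U) S :=
  have hproj := continuousAt_starProjection_weakKer hU hc hS
  hproj.clm_comp (continuousAt_id.clm_comp hproj)

theorem eventually_mul_norm_le_norm_compress (hU : IsClosed (U : Set V)) (hc : 0 < c)
    (hS : ∀ u ∈ U, c * ‖u‖ ≤ ‖S u‖) {X : Submodule 𝕜 V} (hX : X ≤ weakKer S U) {r r' : ℝ}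
    (hr : 0 ≤ r) (hr' : r' < r)
    (hbound : ∀ u ∈ weakKer S U, u ∈ Xᗮ → r * ‖u‖ ≤ ‖compress S U u‖) :
    ∀ᶠ T in 𝓝 S, ∀ u ∈ weakKer T U, u ∈ Xᗮ → r' * ‖u‖ ≤ ‖compress T U u‖ := by
  have hproj := tendsto_iff_norm_sub_tendsto_zero.1 (continuousAt_starProjection_weakKer hU hc hS)
  have hcompr := tendsto_iff_norm_sub_tendsto_zero.1 (continuousAt_compress hU hc hS)
  have hlim := (hproj.const_mul r).add hcompr
  rw [mul_zero, add_zero] at hlim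
  filter_upwards [hlim.eventually_lt_const (sub_pos.2 hr')] with T hT u hu huX
  set g := (weakKer S U).starProjection u with g_def
  have hgX : g ∈ Xᗮ := fun x hx => by
    rw [← Submodule.inner_starProjection_left_eq_right,
      Submodule.starProjection_eq_self_iff.2 (hX hx)]
    exact huX x hx
  have hg : r * ‖g‖ ≤ ‖compress S U u‖ := by
    convert hbound g (Submodule.starProjection_apply_mem _ u) hgX using 2
    rw [compress_apply, compress_apply_of_mem (Submodule.starProjection_apply_mem _ u)]
  have hug : ‖u‖ ≤ ‖g‖ +
      ‖(weakKer T U).starProjection - (weakKer S U).starProjection‖ * ‖u‖ := by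
    calc ‖u‖ = ‖g + ((weakKer T U).starProjection - (weakKer S U).starProjection) u‖ := by
          rw [sub_apply, Submodule.starProjection_eq_self_iff.2 hu, g_def, add_sub_cancel]
      _ ≤ _ := norm_add_le_of_le le_rfl (ContinuousLinearMap.le_opNorm _ u)
  have hST : ‖compress S U u‖ ≤ ‖compress T U u‖ + ‖compress T U - compress S U‖ * ‖u‖ := by
    calc ‖compress S U u‖ = ‖compress T U u - (compress T U - compress S U) u‖ := by
          rw [sub_apply, sub_sub_cancel]
      _ ≤ _ := norm_sub_le_of_le le_rfl (ContinuousLinearMap.le_opNorm _ u)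
  nlinarith [mul_le_mul_of_nonneg_left hug hr, mul_le_mul_of_nonneg_right hT.le (norm_nonneg u)]

theorem norm_compress_le_of_mem (hS : (S : V →ₗ[𝕜] V).IsSymmetric) (hU : IsClosed (U : Set V))
    (hc : 0 < c) (hT : ∀ u ∈ U, c * ‖u‖ ≤ ‖T u‖) {m : V}
    (hm : m ∈ S.ker ∨ m ∈ compressedKer S U) :
    ‖compress T U m‖ ≤ (1 + ‖T‖ / c) * (‖T - S‖ * ‖m‖) := by
  set P := (weakKer T U).starProjection with P_def
  have hmS : m ∈ weakKer S U := hm.elim (fun h => ker_le_weakKer hS h) fun h => h.2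
  have hPm : ‖P m - m‖ ≤ ‖T - S‖ / c * ‖m‖ := by
    rw [norm_sub_rev, norm_sub_rev T]
    exact norm_sub_starProjection_weakKer_le hU hc hT hmS
  have hPTm : ‖P (T m)‖ ≤ ‖T - S‖ * ‖m‖ := by
    rcases hm with hm | hm
    · refine (Submodule.norm_starProjection_apply_le _ _).trans ?_
      rw [← sub_zero (T m), ← show S m = 0 from hm, ← sub_apply]
      exact (T - S).le_opNorm m
    · rw [P_def, starProjection_weakKer_map_eq_zero hm.1, norm_zero]
      positivity
  have hPTw : ‖P (T (P m - m))‖ ≤ ‖T‖ * (‖T - S‖ / c * ‖m‖) :=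
    (Submodule.norm_starProjection_apply_le _ _).trans (T.le_opNorm_of_le hPm)
  calc ‖compress T U m‖ = ‖P (T m) + P (T (P m - m))‖ := by
        rw [compress_apply, ← map_add, ← map_add, add_sub_cancel]
    _ ≤ ‖T - S‖ * ‖m‖ + ‖T‖ * (‖T - S‖ / c * ‖m‖) := norm_add_le_of_le hPTm hPTw
    _ = (1 + ‖T‖ / c) * (‖T - S‖ * ‖m‖) := by ring

/-- With `u` the projection of `m` to the weak solutions and `w = u - m`, this is the expansion of
`⟪T u, u⟫` that has no mixed term `⟪T w, m⟫`. -/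
theorem re_inner_compress_self (hT : (T : V →ₗ[𝕜] V).IsSymmetric) (m : V) :
    RCLike.re (inner 𝕜 (compress T U m) m) =
      2 * RCLike.re (inner 𝕜 (T m) ((weakKer T U).starProjection m)) -
        RCLike.re (inner 𝕜 (T m) m) +
      RCLike.re (inner 𝕜 (T ((weakKer T U).starProjection m - m))
        ((weakKer T U).starProjection m - m)) := by
  have hre : RCLike.re (inner 𝕜 (T ((weakKer T U).starProjection m)) m) =
      RCLike.re (inner 𝕜 (T m) ((weakKer T U).starProjection m)) := by
    rw [hT.apply_clm, ← inner_conj_symm, RCLike.conj_re]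
  rw [inner_compress_self, map_sub]
  simp only [inner_sub_left, inner_sub_right, map_sub, hre]
  ring

theorem abs_re_inner_compress_sub_le_of_mem_ker (hS : (S : V →ₗ[𝕜] V).IsSymmetric)
    (hTsymm : (T : V →ₗ[𝕜] V).IsSymmetric) (hU : IsClosed (U : Set V)) (hc : 0 < c)
    (hT : ∀ u ∈ U, c * ‖u‖ ≤ ‖T u‖) {m : V} (hm : m ∈ S.ker) :
    |RCLike.re (inner 𝕜 (compress T U m) m) - RCLike.re (inner 𝕜 (T m) m)| ≤
      (2 / c + ‖T‖ / c ^ 2) * (‖T - S‖ * ‖m‖) ^ 2 := by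
  set w := (weakKer T U).starProjection m - m with w_def
  have hw : ‖w‖ ≤ ‖T - S‖ / c * ‖m‖ := by
    rw [norm_sub_rev, norm_sub_rev T]
    exact norm_sub_starProjection_weakKer_le hU hc hT (ker_le_weakKer hS hm)
  have hTm : ‖T m‖ ≤ ‖T - S‖ * ‖m‖ := by
    rw [← sub_zero (T m), ← show S m = 0 from hm, ← sub_apply]
    exact (T - S).le_opNorm m
  have hmixed : |RCLike.re (inner 𝕜 (T m) w)| ≤ ‖T - S‖ * ‖m‖ * (‖T - S‖ / c * ‖m‖) :=
    (RCLike.abs_re_le_norm _).trans <| (norm_inner_le_norm _ _).trans <|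
      mul_le_mul hTm hw (norm_nonneg w) (by positivity)
  have hquad := abs_re_inner_map_le_of_norm_le T hw
  have hsum : RCLike.re (inner 𝕜 (compress T U m) m) - RCLike.re (inner 𝕜 (T m) m) =
      2 * RCLike.re (inner 𝕜 (T m) w) + RCLike.re (inner 𝕜 (T w) w) := by
    rw [re_inner_compress_self hTsymm, ← w_def,
      show (weakKer T U).starProjection m = m + w from (add_sub_cancel _ _).symm, inner_add_right,
      map_add]
    ring
  rw [hsum]
  calc _ ≤ 2 * (‖T - S‖ * ‖m‖ * (‖T - S‖ / c * ‖m‖)) + ‖T‖ * (‖T - S‖ / c * ‖m‖) ^ 2 := by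
        rw [abs_le] at *
        constructor <;> linarith
    _ = (2 / c + ‖T‖ / c ^ 2) * (‖T - S‖ * ‖m‖) ^ 2 := by ring

theorem abs_re_inner_compress_add_le_of_mem_compressedKer
    (hTsymm : (T : V →ₗ[𝕜] V).IsSymmetric) (hU : IsClosed (U : Set V)) (hc : 0 < c)
    (hT : ∀ u ∈ U, c * ‖u‖ ≤ ‖T u‖) {m : V} (hm : m ∈ compressedKer S U) :
    |RCLike.re (inner 𝕜 (compress T U m) m) + RCLike.re (inner 𝕜 (T m) m)| ≤
      ‖T‖ / c ^ 2 * (‖T - S‖ * ‖m‖) ^ 2 := by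
  have hw : ‖(weakKer T U).starProjection m - m‖ ≤ ‖T - S‖ / c * ‖m‖ := by
    rw [norm_sub_rev, norm_sub_rev T]
    exact norm_sub_starProjection_weakKer_le hU hc hT hm.2
  have hmixed : inner 𝕜 (T m) ((weakKer T U).starProjection m) = 0 :=
    mem_weakKer.1 (Submodule.starProjection_apply_mem _ m) m hm.1
  rw [re_inner_compress_self hTsymm, hmixed, map_zero, mul_zero, zero_sub, neg_add_eq_sub,
    sub_add_cancel]
  exact (abs_re_inner_map_le_of_norm_le T hw).trans_eq (by ring)

end Perturbation

noncomputable section Pencil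

variable {𝕜 V : Type*} [RCLike 𝕜] [NormedAddCommGroup V] [InnerProductSpace 𝕜 V]

/-- The operator pencil `1 - μ K`, with `K = A_N⁻¹` on `H¹` in the application. -/
def pencil (K : V →L[𝕜] V) (μ : ℝ) : V →L[𝕜] V := 1 - (μ : 𝕜) • K

variable {K : V →L[𝕜] V} {U : Submodule 𝕜 V} {l μ : ℝ}

theorem pencil_apply (u : V) : pencil K μ u = u - (μ : 𝕜) • K u := rfl

theorem isSymmetric_pencil (hK : (K : V →ₗ[𝕜] V).IsSymmetric) :
    (pencil K μ : V →ₗ[𝕜] V).IsSymmetric :=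
  LinearMap.IsSymmetric.one.sub (hK.smul (RCLike.conj_ofReal μ))

@[fun_prop]
theorem continuous_pencil : Continuous (pencil K) := by
  unfold pencil
  fun_prop

theorem pencil_sub_pencil : pencil K μ - pencil K l = ((l - μ : ℝ) : 𝕜) • K := by
  rw [pencil, pencil, RCLike.ofReal_sub, sub_smul]
  abel

theorem norm_pencil_sub_pencil : ‖pencil K μ - pencil K l‖ = |l - μ| * ‖K‖ := by
  rw [pencil_sub_pencil, norm_smul, RCLike.norm_ofReal]

theorem exists_pencil_eq_smul_of_mem_ker (hμ : μ ≠ l) :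
    ∃ z : 𝕜, z ≠ 0 ∧ ∀ u ∈ (pencil K l).ker, pencil K μ u = z • u := by
  rcases eq_or_ne l 0 with rfl | hl
  · refine ⟨1, one_ne_zero, fun u hu => ?_⟩
    have hu' : u = 0 := by simpa [pencil_apply] using hu
    rw [hu', map_zero, smul_zero]
  · have hl' : (l : 𝕜) ≠ 0 := RCLike.ofReal_ne_zero.2 hl
    refine ⟨(l : 𝕜)⁻¹ * ((l - μ : ℝ) : 𝕜),
      mul_ne_zero (inv_ne_zero hl') (RCLike.ofReal_ne_zero.2 (sub_ne_zero.2 hμ.symm)),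
      fun u hu => ?_⟩
    have hKu : u = (l : 𝕜) • K u := sub_eq_zero.1 hu
    rw [pencil_apply, mul_smul, eq_inv_smul_iff₀ hl', RCLike.ofReal_sub, sub_smul, smul_sub,
      smul_comm, ← hKu]

theorem map_pencil_of_le_ker {C : Submodule 𝕜 V} (hμ : μ ≠ l) (hC : C ≤ (pencil K l).ker) :
    C.map (pencil K μ).toLinearMap = C := by
  obtain ⟨z, hz, hsmul⟩ := exists_pencil_eq_smul_of_mem_ker (K := K) hμ
  refine le_antisymm ?_ fun u hu => ⟨z⁻¹ • u, C.smul_mem _ hu, ?_⟩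
  · rintro _ ⟨u, hu, rfl⟩
    exact (hsmul u (hC hu)).symm ▸ C.smul_mem z hu
  · change pencil K μ (z⁻¹ • u) = u
    rw [map_smul, hsmul u (hC hu), inv_smul_smul₀ hz]

theorem re_inner_pencil (u : V) : RCLike.re (inner 𝕜 (pencil K μ u) u) =
    ‖u‖ ^ 2 - μ * RCLike.re (inner 𝕜 (K u) u) := by
  rw [pencil_apply, inner_sub_left, map_sub, inner_self_eq_norm_sq, inner_smul_left,
    RCLike.conj_ofReal, RCLike.re_ofReal_mul]

theorem pos_of_re_inner_pencil_eq_zero (hK : ∀ u, 0 ≤ RCLike.re (inner 𝕜 (K u) u)) {m : V}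
    (hm : m ≠ 0) (hml : RCLike.re (inner 𝕜 (pencil K l m) m) = 0) : 0 < l := by
  rw [re_inner_pencil, sub_eq_zero] at hml
  exact pos_of_mul_pos_left (hml ▸ pow_pos (norm_pos_iff.2 hm) 2) (hK m)

theorem re_inner_pencil_eq (hl : l ≠ 0) {m : V}
    (hm : RCLike.re (inner 𝕜 (pencil K l m) m) = 0) :
    RCLike.re (inner 𝕜 (pencil K μ m) m) = (l - μ) / l * ‖m‖ ^ 2 := by
  rw [re_inner_pencil, sub_eq_zero] at *
  rw [hm, div_mul_eq_mul_div, eq_div_iff hl]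
  ring

theorem abs_mul_sq_lt_of_abs_sub_le {s n x y a k ε A M : ℝ} (hs : s ≠ 0) (hn : 0 < n)
    (hε : 0 ≤ ε) (hy : |y| ≤ M * (|s| * k * n)) (hx : |x - s * a * n ^ 2| ≤ A * (|s| * k * n) ^ 2)
    (hsmall : |s| * ((M ^ 2 + ε * A) * k ^ 2) < ε * a) : |s| * y ^ 2 < ε * (s * x) := by
  have hy2 : y ^ 2 ≤ (M * (|s| * k * n)) ^ 2 := sq_le_sq.2 (hy.trans (le_abs_self _))
  have hsx : s * (s * a * n ^ 2) - |s| * (A * (|s| * k * n) ^ 2) ≤ s * x := by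
    have h : |s * (x - s * a * n ^ 2)| ≤ |s| * (A * (|s| * k * n) ^ 2) := by
      rw [abs_mul]
      exact mul_le_mul_of_nonneg_left hx (abs_nonneg s)
    linarith [(abs_le.1 h).1]
  have hs2 : |s| ^ 2 = s ^ 2 := sq_abs s
  have hlt := mul_lt_mul_of_pos_left hsmall (by positivity : 0 < s ^ 2 * n ^ 2)
  calc |s| * y ^ 2 ≤ |s| * (M * (|s| * k * n)) ^ 2 := mul_le_mul_of_nonneg_left hy2 (abs_nonneg s)
    _ = s ^ 2 * n ^ 2 * (|s| * (M ^ 2 * k ^ 2)) := by rw [← hs2]; ring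
    _ < s ^ 2 * n ^ 2 * (ε * a) - ε * (|s| * (A * (|s| * k * n) ^ 2)) := by
      rw [mul_pow (|s| * k), mul_pow |s|, hs2]
      linarith
    _ ≤ ε * (s * x) := by linarith [mul_le_mul_of_nonneg_left hsx hε]

theorem eventually_abs_mul_sq_lt_of_re_inner_pencil_eq_zero
    (hK : ∀ u, 0 ≤ RCLike.re (inner 𝕜 (K u) u)) {A M : ℝ → ℝ} (hA : ContinuousAt A l)
    (hM : ContinuousAt M l) {ε : ℝ} (hε : 0 < ε) :
    ∀ᶠ μ in 𝓝[≠] l, ∀ m ≠ 0, RCLike.re (inner 𝕜 (pencil K l m) m) = 0 → ∀ x y : ℝ,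
      |y| ≤ M μ * (‖pencil K μ - pencil K l‖ * ‖m‖) →
      |x - RCLike.re (inner 𝕜 (pencil K μ m) m)| ≤
        A μ * (‖pencil K μ - pencil K l‖ * ‖m‖) ^ 2 →
      |l - μ| * y ^ 2 < ε * ((l - μ) * x) := by
  rcases le_or_gt l 0 with hl | hl
  · exact .of_forall fun μ m hm hml => absurd (pos_of_re_inner_pencil_eq_zero hK hm hml) hl.not_gt
  · have hsmall : ∀ᶠ μ in 𝓝 l, |l - μ| * ((M μ ^ 2 + ε * A μ) * ‖K‖ ^ 2) < ε * l⁻¹ := by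
      refine ContinuousAt.eventually_lt (by fun_prop) continuousAt_const ?_
      rw [sub_self, abs_zero, zero_mul]
      positivity
    filter_upwards [nhdsWithin_le_nhds hsmall, self_mem_nhdsWithin] with μ hμ hne
      m hm hml x y hy hx
    rw [norm_pencil_sub_pencil] at hy hx
    rw [re_inner_pencil_eq hl.ne' hml, div_eq_mul_inv] at hx
    exact abs_mul_sq_lt_of_abs_sub_le (sub_ne_zero.2 (Ne.symm hne)) (norm_pos_iff.2 hm) hε.le hy
      hx hμ

section TestVectors

variable [CompleteSpace V] (hK : (K : V →ₗ[𝕜] V).IsSymmetric)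
  (hpos : ∀ u, 0 ≤ RCLike.re (inner 𝕜 (K u) u)) (hU : IsClosed (U : Set V)) {c : ℝ} (hc : 0 < c)
  (hbound : ∀ u ∈ U, c * ‖u‖ ≤ ‖pencil K l u‖) {ε : ℝ} (hε : 0 < ε)
include hc hbound

omit [CompleteSpace V] in
theorem eventually_half_mul_norm_le_norm_pencil :
    ∀ᶠ μ in 𝓝 l, ∀ u ∈ U, c / 2 * ‖u‖ ≤ ‖pencil K μ u‖ := by
  have hlim := tendsto_iff_norm_sub_tendsto_zero.1
    ((continuous_pencil (K := K)).continuousAt (x := l))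
  filter_upwards [hlim.eventually_le_const (half_pos hc)] with μ hμ u hu
  exact half_mul_norm_le_of_norm_sub_le hbound hμ hu

include hK hpos hU hε

theorem eventually_sq_norm_compress_lt_of_mem_ker :
    ∀ᶠ μ in 𝓝[≠] l, ∀ m ∈ (pencil K l).ker, m ≠ 0 →
      |l - μ| * ‖compress (pencil K μ) U m‖ ^ 2 <
        ε * ((l - μ) * RCLike.re (inner 𝕜 (compress (pencil K μ) U m) m)) := by
  filter_upwards [nhdsWithin_le_nhds (eventually_half_mul_norm_le_norm_pencil hc hbound),
    eventually_abs_mul_sq_lt_of_re_inner_pencil_eq_zero hpos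
      (A := fun μ => 2 / (c / 2) + ‖pencil K μ‖ / (c / 2) ^ 2)
      (M := fun μ => 1 + ‖pencil K μ‖ / (c / 2)) (by fun_prop) (by fun_prop) hε]
    with μ hμ htest m hm hm0
  have hml : RCLike.re (inner 𝕜 (pencil K l m) m) = 0 := by
    rw [show pencil K l m = 0 from hm, inner_zero_left, map_zero]
  refine htest m hm0 hml _ _ ?_ (abs_re_inner_compress_sub_le_of_mem_ker (isSymmetric_pencil hK)
    (isSymmetric_pencil hK) hU (half_pos hc) hμ hm)
  rw [abs_norm]
  exact norm_compress_le_of_mem (isSymmetric_pencil hK) hU (half_pos hc) hμ (.inl hm)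

theorem eventually_sq_norm_compress_lt_of_mem_compressedKer :
    ∀ᶠ μ in 𝓝[≠] l, ∀ m ∈ compressedKer (pencil K l) U, m ≠ 0 →
      |l - μ| * ‖compress (pencil K μ) U m‖ ^ 2 <
        ε * ((μ - l) * RCLike.re (inner 𝕜 (compress (pencil K μ) U m) m)) := by
  filter_upwards [nhdsWithin_le_nhds (eventually_half_mul_norm_le_norm_pencil hc hbound),
    eventually_abs_mul_sq_lt_of_re_inner_pencil_eq_zero hpos
      (A := fun μ => ‖pencil K μ‖ / (c / 2) ^ 2)
      (M := fun μ => 1 + ‖pencil K μ‖ / (c / 2)) (by fun_prop) (by fun_prop) hε]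
    with μ hμ htest m hm hm0
  have hml : RCLike.re (inner 𝕜 (pencil K l m) m) = 0 := by
    rw [mem_weakKer.1 hm.2 m hm.1, map_zero]
  convert htest m hm0 hml (-RCLike.re (inner 𝕜 (compress (pencil K μ) U m) m))
    ‖compress (pencil K μ) U m‖ ?_ ?_ using 2
  · ring
  · rw [abs_norm]
    exact norm_compress_le_of_mem (isSymmetric_pencil hK) hU (half_pos hc) hμ (.inr hm)
  · rw [← neg_add', abs_neg]
    exact abs_re_inner_compress_add_le_of_mem_compressedKer (isSymmetric_pencil hK) hU
      (half_pos hc) hμ hm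

end TestVectors

end Pencil

section CommonKernel

variable {𝕜 V : Type*} [RCLike 𝕜] [NormedAddCommGroup V] [InnerProductSpace 𝕜 V]
  {T K : V →L[𝕜] V} {U : Submodule 𝕜 V} {l : ℝ}

instance [FiniteDimensional 𝕜 T.ker] : FiniteDimensional 𝕜 (commonKer T U) :=
  Submodule.finiteDimensional_inf_right U T.ker

variable [CompleteSpace V]

theorem exists_mul_norm_le_norm_map_of_mem_commonKer_orthogonal (hU : IsClosed (U : Set V))
    (hTU : IsClosed (U.map T.toLinearMap : Set V)) :
    ∃ c > 0, ∀ u ∈ (commonKer T U)ᗮ ⊓ U, c * ‖u‖ ≤ ‖T u‖ := by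
  have : CompleteSpace U := hU.completeSpace_coe
  have hrange : IsClosed ((T ∘L U.subtypeL).range : Set V) := by
    convert hTU
    ext y
    simp
  obtain ⟨c, hc, h⟩ := exists_norm_sub_ker_le (T ∘L U.subtypeL) hrange
  refine ⟨c, hc, fun u hu => ?_⟩
  obtain ⟨n, hn, hun⟩ := h ⟨u, hu.2⟩
  exact (mul_le_mul_of_nonneg_left
    (norm_le_norm_sub_of_mem_orthogonal hu.1 ⟨n.2, hn⟩) hc.le).trans hun

theorem mul_norm_le_norm_compress_of_mem_orthogonal (hT : (T : V →ₗ[𝕜] V).IsSymmetric)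
    [U.HasOrthogonalProjection] (hTU : IsClosed (U.map T.toLinearMap : Set V)) {c : ℝ}
    (hc : 0 ≤ c) (hker : ∀ v, ∃ n ∈ T.ker, c * ‖v - n‖ ≤ ‖T v‖)
    (hcompr : ∀ v ∈ U, ∃ d ∈ compressedKer T U, c * ‖v - d‖ ≤ ‖U.starProjection (T v)‖)
    {u : V} (hu : u ∈ weakKer T U) (huM : u ∈ (T.ker ⊔ compressedKer T U)ᗮ) :
    c / 2 * ‖u‖ ≤ ‖compress T U u‖ := by
  obtain ⟨w, hw, huw⟩ := exists_norm_sub_le_norm_compress hT hTU hc hker hcompr hu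
  exact (mul_le_mul_of_nonneg_left
    (norm_le_norm_sub_of_mem_orthogonal huM hw) (by positivity)).trans huw

variable [FiniteDimensional 𝕜 (pencil K l).ker]

/-- Off `μ = l` the common kernel at `l` reduces the pencil and meets no weak solutions, so it may
be split off; on the rest of `U` the operator at `l` is injective with closed range. -/
theorem eventually_mul_norm_le_norm_compress_pencil (hK : (K : V →ₗ[𝕜] V).IsSymmetric)
    (hU : IsClosed (U : Set V)) (hKU : IsClosed (U.map (pencil K l).toLinearMap : Set V))
    {r r' : ℝ} (hr : 0 ≤ r) (hr' : r' < r)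
    (hbound : ∀ u ∈ weakKer (pencil K l) U,
      u ∈ ((pencil K l).ker ⊔ compressedKer (pencil K l) U)ᗮ →
      r * ‖u‖ ≤ ‖compress (pencil K l) U u‖) :
    ∀ᶠ μ in 𝓝[≠] l, ∀ u ∈ weakKer (pencil K μ) U,
      u ∈ ((commonKer (pencil K l) U)ᗮ ⊓ ((pencil K l).ker ⊔ compressedKer (pencil K l) U))ᗮ →
      r' * ‖u‖ ≤ ‖compress (pencil K μ) U u‖ := by
  set C := commonKer (pencil K l) U
  set M := (pencil K l).ker ⊔ compressedKer (pencil K l) U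
  have hCU : C ≤ U := inf_le_left
  have hCM : C ≤ M := commonKer_le_ker.trans le_sup_left
  have hweak : weakKer (pencil K l) U = weakKer (pencil K l) (Cᗮ ⊓ U) :=
    weakKer_eq_weakKer_orthogonal_inf inf_le_left commonKer_le_ker
  obtain ⟨c, hc, hcbound⟩ := exists_mul_norm_le_norm_map_of_mem_commonKer_orthogonal hU hKU
  have hnear := eventually_mul_norm_le_norm_compress
    (C.isClosed_orthogonal.inter hU) hc hcbound
    (hweak ▸ ker_sup_compressedKer_le_weakKer (isSymmetric_pencil hK)) hr hr'
    (by simpa only [compress, hweak] using hbound)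
  filter_upwards [nhdsWithin_le_nhds (continuous_pencil.continuousAt.eventually hnear),
    self_mem_nhdsWithin] with μ hμ hne u hu huW
  have hCmap : C.map (pencil K μ).toLinearMap = C := map_pencil_of_le_ker hne commonKer_le_ker
  rw [weakKer_eq_inf_weakKer_orthogonal_inf hCU, hCmap] at hu
  have huM : u ∈ Mᗮ := by
    rw [← Submodule.sup_orthogonal_inf_of_hasOrthogonalProjection hCM, ← Submodule.inf_orthogonal]
    exact ⟨hu.1, huW⟩
  rw [compress_apply_of_mem_orthogonal (isSymmetric_pencil hK) inf_le_left hCmap hu.1]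
  exact hμ u hu.2 huM

theorem eventually_sq_norm_compress_lt_of_mem_commonKer_orthogonal
    (hK : (K : V →ₗ[𝕜] V).IsSymmetric) (hpos : ∀ u, 0 ≤ RCLike.re (inner 𝕜 (K u) u))
    (hU : IsClosed (U : Set V)) (hKU : IsClosed (U.map (pencil K l).toLinearMap : Set V))
    {ε : ℝ} (hε : 0 < ε) :
    ∀ᶠ μ in 𝓝[≠] l, ∀ m ∈ (commonKer (pencil K l) U)ᗮ, m ≠ 0 →
      (m ∈ (pencil K l).ker → |l - μ| * ‖compress (pencil K μ) U m‖ ^ 2 <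
        ε * ((l - μ) * RCLike.re (inner 𝕜 (compress (pencil K μ) U m) m))) ∧
      (m ∈ compressedKer (pencil K l) U → |μ - l| * ‖compress (pencil K μ) U m‖ ^ 2 <
        ε * ((μ - l) * RCLike.re (inner 𝕜 (compress (pencil K μ) U m) m))) := by
  set C := commonKer (pencil K l) U
  obtain ⟨c, hc, hcbound⟩ := exists_mul_norm_le_norm_map_of_mem_commonKer_orthogonal hU hKU
  have hU' : IsClosed (Cᗮ ⊓ U : Set V) := C.isClosed_orthogonal.inter hU
  filter_upwards [self_mem_nhdsWithin,
    eventually_sq_norm_compress_lt_of_mem_ker hK hpos hU' hc hcbound hε,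
    eventually_sq_norm_compress_lt_of_mem_compressedKer hK hpos hU' hc hcbound hε]
    with μ hne hker hcompr m hm hm0
  rw [compress_apply_of_mem_orthogonal (isSymmetric_pencil hK) inf_le_left
    (map_pencil_of_le_ker hne commonKer_le_ker) hm]
  have hweak : weakKer (pencil K l) U = weakKer (pencil K l) (Cᗮ ⊓ U) :=
    weakKer_eq_weakKer_orthogonal_inf inf_le_left commonKer_le_ker
  refine ⟨fun hmN => hker m hmN hm0, fun hmD => ?_⟩
  rw [abs_sub_comm]
  exact hcompr m ⟨⟨hm, hmD.1⟩, hweak.le hmD.2⟩ hm0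

end CommonKernel

theorem compressedKer_top {𝕜 V : Type*} [RCLike 𝕜] [NormedAddCommGroup V]
    [InnerProductSpace 𝕜 V] {T : V →L[𝕜] V} (hT : (T : V →ₗ[𝕜] V).IsSymmetric) :
    compressedKer T ⊤ = T.ker := by
  refine le_antisymm (fun u hu => ?_) (le_inf le_top (ker_le_weakKer hT))
  change T u = 0
  rw [← inner_self_eq_zero (𝕜 := 𝕜), ← hT.apply_clm]
  exact mem_weakKer.1 hu.2 _ trivial

namespace PartialOp

variable {H : Type*} [NormedAddCommGroup H] [InnerProductSpace ℂ H]

theorem range_shift_of_mem_graph_iff {T : H →ₗ.[ℂ] H} {R : H →L[ℂ] H}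
    (hTR : ∀ x f, (x, f) ∈ T.graph ↔ x = R f) (z : ℂ) :
    LinearMap.range (shift T z) = (1 - z • R).range := by
  ext y
  constructor
  · rintro ⟨x, rfl⟩
    refine ⟨T x, ?_⟩
    change T x - z • R (T x) = T x - z • (x : H)
    rw [← (hTR x (T x)).1 (T.mem_graph x)]
  · rintro ⟨f, rfl⟩
    obtain ⟨x, hx, hxf⟩ := (LinearPMap.mem_graph_iff _).1 ((hTR (R f) f).2 rfl)
    refine ⟨x, ?_⟩
    change T x - z • (x : H) = f - z • R f
    rw [hx, hxf]

theorem finiteDimensional_eigenspace {T : H →ₗ.[ℂ] H} {z : ℂ} (hz : z ∉ essSpectrum T) :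
    FiniteDimensional ℂ (eigenspace T z) := by
  have : FiniteDimensional ℂ (LinearMap.ker (shift T z)) := (not_not.1 hz).1
  unfold eigenspace
  infer_instance

end PartialOp

noncomputable section Operators

namespace ClosedPositiveForm

open PartialOp

variable {H : Type*} [NormedAddCommGroup H] [InnerProductSpace ℂ H] (a : ClosedPositiveForm H)

section Eigenspaces

variable {U : Submodule ℂ a.Space} (hU : Dense (a.incl '' U))
include hU

theorem mem_eigenspace_op (z : ℂ) (x : H) : x ∈ eigenspace (a.op U U) z ↔
    ∃ u ∈ U, a.incl u = x ∧ ∀ v ∈ U, inner ℂ (z • x) (a.incl v) = inner ℂ u v := by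
  rw [mem_eigenspace_iff, op_graph a hU]
  rfl

theorem inner_eq_zero_of_mem_eigenspace_op {z : ℂ} {l : ℝ} (hz : z ≠ l) {x y : H}
    (hx : x ∈ eigenspace (a.op U U) z) (hy : y ∈ eigenspace (a.op U U) l) :
    inner ℂ y x = 0 := by
  obtain ⟨u, hu, rfl, hxu⟩ := (a.mem_eigenspace_op hU z x).1 hx
  obtain ⟨v, hv, rfl, hyv⟩ := (a.mem_eigenspace_op hU l y).1 hy
  have hconj := congrArg (starRingEnd ℂ) (hxu v hv)
  rw [inner_conj_symm, inner_conj_symm, inner_smul_right, ← hyv u hu, inner_smul_left,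
    Complex.conj_ofReal, ← sub_eq_zero, ← sub_mul] at hconj
  exact (mul_eq_zero.1 hconj).resolve_left (sub_ne_zero.2 hz)

end Eigenspaces

variable [CompleteSpace H]

/-- The bounded operator on `H¹` that represents the inner product of `H`; it is the restriction
of `A_N⁻¹` to `H¹`. -/
def gram : a.Space →L[ℂ] a.Space :=
  a.invN ∘L a.incl

theorem inner_gram_left (u v : a.Space) :
    inner ℂ (a.gram u) v = inner ℂ (a.incl u) (a.incl v) :=
  ContinuousLinearMap.adjoint_inner_left a.incl v (a.incl u)

theorem isSymmetric_gram : a.gram.toLinearMap.IsSymmetric := fun u v => by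
  rw [ContinuousLinearMap.coe_coe, inner_gram_left, ← inner_conj_symm u, inner_gram_left,
    inner_conj_symm]

theorem re_inner_gram_nonneg (u : a.Space) : 0 ≤ (inner ℂ (a.gram u) u).re := by
  rw [inner_gram_left]
  exact inner_self_nonneg (𝕜 := ℂ)

theorem mem_weakKer_gram {U : Submodule ℂ a.Space} {μ : ℝ} {u : a.Space} :
    u ∈ weakKer (pencil a.gram μ) U ↔
      ∀ v ∈ U, inner ℂ ((μ : ℂ) • a.incl u) (a.incl v) = inner ℂ u v := by
  rw [mem_weakKer]
  refine forall₂_congr fun v _ => ?_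
  rw [(isSymmetric_pencil a.isSymmetric_gram).apply_clm, ← inner_conj_symm, map_eq_zero,
    pencil_apply, inner_sub_left, inner_smul_left, inner_gram_left, inner_smul_left, sub_eq_zero,
    eq_comm]
  rfl

theorem isClosed_range_pencil_gram {l : ℝ} (hl : (l : ℂ) ∉ essSpectrum a.opN) :
    IsClosed ((pencil a.gram l).range : Set a.Space) := by
  refine isClosed_range_one_sub_smul_comp_comm (a := a.incl) (b := a.invN) ?_
  rw [← range_shift_of_mem_graph_iff a.mem_graph_opN]
  exact (not_not.1 hl).2.1

section Subspace

variable {U : Submodule ℂ a.Space} (hU : Dense (a.incl '' U)) {l : ℝ}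
include hU

theorem eigenspace_op (l : ℝ) :
    eigenspace (a.op U U) l = (compressedKer (pencil a.gram l) U).map a.incl.toLinearMap := by
  ext x
  rw [mem_eigenspace_op a hU]
  constructor
  · rintro ⟨u, hu, rfl, h⟩
    exact ⟨u, ⟨hu, a.mem_weakKer_gram.2 h⟩, rfl⟩
  · rintro ⟨u, ⟨hu, h⟩, rfl⟩
    exact ⟨u, hu, rfl, a.mem_weakKer_gram.1 h⟩

theorem finiteDimensional_compressedKer (hl : (l : ℂ) ∉ essSpectrum (a.op U U)) :
    FiniteDimensional ℂ (compressedKer (pencil a.gram l) U) := by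
  have hfin := finiteDimensional_eigenspace hl
  rw [eigenspace_op a hU] at hfin
  exact (Submodule.equivMapOfInjective a.incl.toLinearMap a.incl_injective
    _).symm.finiteDimensional

variable [CompleteSpace U]

theorem mem_graph_op_iff (x f : H) :
    (x, f) ∈ (a.op U U).graph ↔ x = (a.incl ∘L U.starProjection ∘L a.invN) f := by
  have hinv : ∀ v, inner ℂ (a.invN f) v = inner ℂ f (a.incl v) := fun v =>
    ContinuousLinearMap.adjoint_inner_left a.incl v f
  rw [op_graph a hU]
  constructor
  · rintro ⟨u, hu, rfl, h⟩
    have hproj : U.starProjection (a.invN f) = u :=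
      Submodule.eq_starProjection_of_mem_of_inner_eq_zero hu fun v hv => by
        rw [inner_sub_left, hinv, h v hv, sub_self]
    exact congrArg a.incl hproj.symm
  · rintro rfl
    refine ⟨_, Submodule.starProjection_apply_mem U (a.invN f), rfl, fun v hv => ?_⟩
    rw [← hinv, Submodule.inner_starProjection_left_eq_right,
      Submodule.starProjection_eq_self_iff.2 hv]

theorem isClosed_range_compression_pencil_gram (hl : (l : ℂ) ∉ essSpectrum (a.op U U)) :
    IsClosed ((U.orthogonalProjectionOnto ∘L pencil a.gram l ∘L U.subtypeL).range : Set U) := by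
  have hcompr : U.orthogonalProjectionOnto ∘L pencil a.gram l ∘L U.subtypeL =
      1 - (l : ℂ) • ((U.orthogonalProjectionOnto ∘L a.invN) ∘L (a.incl ∘L U.subtypeL)) := by
    ext v
    simp [pencil_apply, gram]
  rw [hcompr]
  refine isClosed_range_one_sub_smul_comp_comm
    (a := a.incl ∘L U.subtypeL) (b := U.orthogonalProjectionOnto ∘L a.invN) ?_
  convert (not_not.1 hl).2.1
  exact (range_shift_of_mem_graph_iff (a.mem_graph_op_iff hU) l).symm

theorem exists_norm_sub_compressedKer_le (hl : (l : ℂ) ∉ essSpectrum (a.op U U)) :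
    ∃ c > 0, ∀ v ∈ U, ∃ d ∈ compressedKer (pencil a.gram l) U,
      c * ‖v - d‖ ≤ ‖U.starProjection (pencil a.gram l v)‖ := by
  obtain ⟨c, hc, h⟩ :=
    exists_norm_sub_ker_le _ (a.isClosed_range_compression_pencil_gram hU hl)
  refine ⟨c, hc, fun v hv => ?_⟩
  obtain ⟨d, hd, hvd⟩ := h ⟨v, hv⟩
  refine ⟨d, ⟨d.2, mem_weakKer.2 fun x hx => ?_⟩, hvd⟩
  have hd0 : U.orthogonalProjectionOnto (pencil a.gram l d) = 0 := hd
  rw [(isSymmetric_pencil a.isSymmetric_gram).apply_clm]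
  exact Submodule.orthogonalProjectionOnto_eq_zero_iff.1 hd0 x hx

end Subspace

theorem finiteDimensional_ker_pencil_gram {l : ℝ} (hl : (l : ℂ) ∉ essSpectrum a.opN) :
    FiniteDimensional ℂ (pencil a.gram l).ker := by
  rw [← compressedKer_top (isSymmetric_pencil a.isSymmetric_gram)]
  exact a.finiteDimensional_compressedKer a.dense_incl_top hl

end ClosedPositiveForm

end Operators

section ProjectedSpans

variable {𝕜 V : Type*} [RCLike 𝕜] [NormedAddCommGroup V] [InnerProductSpace 𝕜 V]
  {E C : Submodule 𝕜 V} [FiniteDimensional 𝕜 C] {s : Set V}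

theorem closure_span_le_orthogonal_sup (hs : ∀ u ∈ s, u ∈ C ∨ u ∈ Eᗮ) :
    (Submodule.span 𝕜 s).topologicalClosure ≤ Eᗮ ⊔ C :=
  Submodule.topologicalClosure_minimal _
    (Submodule.span_le.2 fun u hu =>
      (hs u hu).elim (Submodule.mem_sup_right ·) (Submodule.mem_sup_left ·))
    (Submodule.isClosed_sup_finiteDimensional _ _ (Submodule.isClosed_orthogonal _))

variable [E.HasOrthogonalProjection] (hCE : C ≤ E) (hs : ∀ u ∈ s, u ∈ C ∨ u ∈ Eᗮ)
  (hCs : (C : Set V) ⊆ s)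
include hCE hs hCs

theorem map_starProjection_closure_span :
    (Submodule.span 𝕜 s).topologicalClosure.map E.starProjection.toLinearMap = C := by
  refine le_antisymm ?_ fun c hc => ⟨c, ?_, Submodule.starProjection_eq_self_iff.2 (hCE hc)⟩
  · rintro _ ⟨x, hx, rfl⟩
    obtain ⟨e, he, c, hc, rfl⟩ := Submodule.mem_sup.1 (closure_span_le_orthogonal_sup hs hx)
    rw [map_add, ContinuousLinearMap.coe_coe, (Submodule.starProjection_apply_eq_zero_iff _).2 he,
      Submodule.starProjection_eq_self_iff.2 (hCE hc), zero_add]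
    exact hc
  · exact Submodule.le_topologicalClosure _ (Submodule.subset_span (hCs hc))

theorem map_starProjection_closure_span_orthogonal :
    ((Submodule.span 𝕜 s).topologicalClosureᗮ).map E.starProjection.toLinearMap = Cᗮ ⊓ E := by
  refine le_antisymm ?_ fun y hy => ⟨y, ?_, Submodule.starProjection_eq_self_iff.2 hy.2⟩
  · rintro _ ⟨x, hx, rfl⟩
    refine ⟨fun c hc => ?_, Submodule.starProjection_apply_mem _ _⟩
    rw [ContinuousLinearMap.coe_coe, ← Submodule.inner_starProjection_left_eq_right,
      Submodule.starProjection_eq_self_iff.2 (hCE hc)]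
    exact hx c (Submodule.le_topologicalClosure _ (Submodule.subset_span (hCs hc)))
  · intro x hx
    obtain ⟨e, he, c, hc, rfl⟩ := Submodule.mem_sup.1 (closure_span_le_orthogonal_sup hs hx)
    rw [inner_add_left, hy.1 c hc, add_zero]
    exact Submodule.inner_left_of_mem_orthogonal hy.2 he

end ProjectedSpans

theorem finrank_map_of_injective {R M N : Type*} [Semiring R] [AddCommMonoid M] [AddCommMonoid N]
    [Module R M] [Module R N] {f : M →ₗ[R] N} (hf : Function.Injective f) (p : Submodule R M) :
    Module.finrank R (p.map f) = Module.finrank R p :=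
  (Submodule.equivMapOfInjective f hf p).finrank_eq.symm

namespace PartialOp

theorem eigenproj_eq_starProjection {H : Type*} [NormedAddCommGroup H] [InnerProductSpace ℂ H]
    [CompleteSpace H] (T : H →ₗ.[ℂ] H) (z : ℂ) [FiniteDimensional ℂ (eigenspace T z)] :
    eigenproj T z = (eigenspace T z).starProjection := by
  have hclosed := (eigenspace T z).closed_of_finiteDimensional.submodule_topologicalClosure_eq
  unfold eigenproj
  congr!

end PartialOp

namespace FormPair

open PartialOp

variable {H : Type*} [NormedAddCommGroup H] [InnerProductSpace ℂ H] (P : FormPair H)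

theorem eigenvalue_unique_of_mem_eigenspaces {u : H} {z w : ℂ} (hu : u ≠ 0)
    (hN : u ∈ eigenspace P.AN z) (hD : u ∈ eigenspace P.AD w) : z = w := by
  obtain ⟨x, -, rfl, hx⟩ := (P.a.mem_eigenspace_op P.a.dense_incl_top z u).1 hN
  obtain ⟨y, -, hy, hxy⟩ := (P.a.mem_eigenspace_op P.dense_H₀ w _).1 hD
  obtain rfl := P.a.incl_injective hy
  refine smul_left_injective ℂ hu (sub_eq_zero.1 (P.dense_H₀.eq_zero_of_inner_left ℂ ?_))
  rintro _ ⟨v, hv, rfl⟩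
  rw [inner_sub_left, hx v trivial, hxy v hv, sub_self]

theorem mem_inf_or_mem_orthogonal_of_mem_eigenspaces (l : ℝ) {u : H} {z w : ℂ}
    (hN : u ∈ eigenspace P.AN z) (hD : u ∈ eigenspace P.AD w) :
    u ∈ eigenspace P.AN l ⊓ eigenspace P.AD l ∨
      u ∈ (eigenspace P.AN l)ᗮ ∧ u ∈ (eigenspace P.AD l)ᗮ := by
  rcases eq_or_ne u 0 with rfl | hu
  · exact Or.inl (Submodule.zero_mem _)
  obtain rfl := P.eigenvalue_unique_of_mem_eigenspaces hu hN hD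
  by_cases hz : z = l
  · subst hz
    exact Or.inl ⟨hN, hD⟩
  · exact Or.inr
      ⟨fun _ => P.a.inner_eq_zero_of_mem_eigenspace_op P.a.dense_incl_top hz hN,
        fun _ => P.a.inner_eq_zero_of_mem_eigenspace_op P.dense_H₀ hz hD⟩

variable [CompleteSpace H] (l : ℝ)

theorem nND_eq_finrank_inf [FiniteDimensional ℂ (eigenspace P.AN l)] :
    P.nND l = Module.finrank ℂ (eigenspace P.AN l ⊓ eigenspace P.AD l : Submodule ℂ H) := by
  rw [nND, eigenproj_eq_starProjection, commonSpan,
    map_starProjection_closure_span (C := eigenspace P.AN l ⊓ eigenspace P.AD l) inf_le_left]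
  · rintro u ⟨z, w, hN, hD⟩
    exact (P.mem_inf_or_mem_orthogonal_of_mem_eigenspaces l hN hD).imp_right And.left
  · exact fun u hu => ⟨l, l, hu.1, hu.2⟩

theorem nN_eq_finrank_orthogonal_inf [FiniteDimensional ℂ (eigenspace P.AN l)] :
    P.nN l = Module.finrank ℂ
      ((eigenspace P.AN l ⊓ eigenspace P.AD l)ᗮ ⊓ eigenspace P.AN l : Submodule ℂ H) := by
  rw [nN, eigenproj_eq_starProjection, commonSpan, map_starProjection_closure_span_orthogonal
    (C := eigenspace P.AN l ⊓ eigenspace P.AD l) inf_le_left]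
  · rintro u ⟨z, w, hN, hD⟩
    exact (P.mem_inf_or_mem_orthogonal_of_mem_eigenspaces l hN hD).imp_right And.left
  · exact fun u hu => ⟨l, l, hu.1, hu.2⟩

theorem nD_eq_finrank_orthogonal_inf [FiniteDimensional ℂ (eigenspace P.AD l)] :
    P.nD l = Module.finrank ℂ
      ((eigenspace P.AN l ⊓ eigenspace P.AD l)ᗮ ⊓ eigenspace P.AD l : Submodule ℂ H) := by
  rw [nD, eigenproj_eq_starProjection, commonSpan, map_starProjection_closure_span_orthogonal
    (C := eigenspace P.AN l ⊓ eigenspace P.AD l) inf_le_right]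
  · rintro u ⟨z, w, hN, hD⟩
    exact (P.mem_inf_or_mem_orthogonal_of_mem_eigenspaces l hN hD).imp_right And.right
  · exact fun u hu => ⟨l, l, hu.1, hu.2⟩

theorem eigenspace_AN :
    eigenspace P.AN l = (pencil P.a.gram l).ker.map P.a.incl.toLinearMap := by
  rw [← compressedKer_top (isSymmetric_pencil P.a.isSymmetric_gram),
    ← P.a.eigenspace_op P.a.dense_incl_top]
  rfl

theorem eigenspace_AD : eigenspace P.AD l =
    (compressedKer (pencil P.a.gram l) P.H₀).map P.a.incl.toLinearMap :=
  P.a.eigenspace_op P.dense_H₀ l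

variable [FiniteDimensional ℂ (pencil P.a.gram l).ker]

theorem nND_eq_finrank_commonKer :
    P.nND l = Module.finrank ℂ (commonKer (pencil P.a.gram l) P.H₀) := by
  have : FiniteDimensional ℂ (eigenspace P.AN l) := P.eigenspace_AN l ▸ inferInstance
  rw [nND_eq_finrank_inf, eigenspace_AN, eigenspace_AD, ← Submodule.map_inf _ P.a.incl_injective,
    ← commonKer_eq_ker_inf_compressedKer (isSymmetric_pencil P.a.isSymmetric_gram)]
  exact finrank_map_of_injective P.a.incl_injective _

theorem finrank_orthogonal_commonKer_inf_ker : Module.finrank ℂ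
    ((commonKer (pencil P.a.gram l) P.H₀)ᗮ ⊓ (pencil P.a.gram l).ker : Submodule ℂ P.a.Space) =
      P.nN l := by
  have : FiniteDimensional ℂ (eigenspace P.AN l) := P.eigenspace_AN l ▸ inferInstance
  refine Submodule.finrank_add_inf_finrank_orthogonal' commonKer_le_ker ?_
  rw [← nND_eq_finrank_commonKer, nND_eq_finrank_inf, nN_eq_finrank_orthogonal_inf,
    Submodule.finrank_add_inf_finrank_orthogonal inf_le_left, eigenspace_AN]
  exact finrank_map_of_injective P.a.incl_injective _

variable [FiniteDimensional ℂ (compressedKer (pencil P.a.gram l) P.H₀)]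

theorem finrank_orthogonal_commonKer_inf_compressedKer : Module.finrank ℂ
    ((commonKer (pencil P.a.gram l) P.H₀)ᗮ ⊓ compressedKer (pencil P.a.gram l) P.H₀ :
      Submodule ℂ P.a.Space) = P.nD l := by
  have : FiniteDimensional ℂ (eigenspace P.AN l) := P.eigenspace_AN l ▸ inferInstance
  have : FiniteDimensional ℂ (eigenspace P.AD l) := P.eigenspace_AD l ▸ inferInstance
  refine Submodule.finrank_add_inf_finrank_orthogonal'
    (commonKer_le_compressedKer (isSymmetric_pencil P.a.isSymmetric_gram)) ?_
  rw [← nND_eq_finrank_commonKer, nND_eq_finrank_inf, nD_eq_finrank_orthogonal_inf,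
    Submodule.finrank_add_inf_finrank_orthogonal inf_le_right, eigenspace_AD]
  exact finrank_map_of_injective P.a.incl_injective _

theorem finrank_ker_sup_compressedKer : Module.finrank ℂ
    ((pencil P.a.gram l).ker ⊔ compressedKer (pencil P.a.gram l) P.H₀ :
      Submodule ℂ P.a.Space) = P.nN l + P.nD l + P.nND l := by
  have hsymm := isSymmetric_pencil (μ := l) P.a.isSymmetric_gram
  have hsup := Submodule.finrank_sup_add_finrank_inf_eq (pencil P.a.gram l).ker
    (compressedKer (pencil P.a.gram l) P.H₀)
  have hN := Submodule.finrank_add_inf_finrank_orthogonal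
    (commonKer_le_ker (T := pencil P.a.gram l) (U := P.H₀))
  have hD := Submodule.finrank_add_inf_finrank_orthogonal
    (commonKer_le_compressedKer (U := P.H₀) hsymm)
  rw [finrank_orthogonal_commonKer_inf_ker, ← nND_eq_finrank_commonKer] at hN
  rw [finrank_orthogonal_commonKer_inf_compressedKer, ← nND_eq_finrank_commonKer] at hD
  rw [← commonKer_eq_ker_inf_compressedKer hsymm, ← nND_eq_finrank_commonKer] at hsup
  omega

theorem finrank_orthogonal_commonKer_inf_sup : Module.finrank ℂ
    ((commonKer (pencil P.a.gram l) P.H₀)ᗮ ⊓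
      ((pencil P.a.gram l).ker ⊔ compressedKer (pencil P.a.gram l) P.H₀) :
      Submodule ℂ P.a.Space) = P.nN l + P.nD l := by
  refine Submodule.finrank_add_inf_finrank_orthogonal' (commonKer_le_ker.trans le_sup_left) ?_
  rw [← nND_eq_finrank_commonKer, finrank_ker_sup_compressedKer, add_comm]

end FormPair

theorem lt_mul_of_abs_mul_lt_of_pos {s x y ε : ℝ} (hs : 0 < s) (h : |s| * y < ε * (s * x)) :
    y < ε * x := by
  rw [abs_of_pos hs, mul_left_comm] at h
  exact lt_of_mul_lt_mul_left h hs.le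

theorem lt_mul_neg_of_abs_mul_lt_of_neg {s x y ε : ℝ} (hs : s < 0)
    (h : |s| * y < ε * (s * x)) : y < ε * -x := by
  refine lt_mul_of_abs_mul_lt_of_pos (neg_pos.2 hs) ?_
  rwa [abs_neg, neg_mul_neg]

theorem weakKer_inf_ker_compress {𝕜 V : Type*} [RCLike 𝕜] [NormedAddCommGroup V]
    [InnerProductSpace 𝕜 V] [CompleteSpace V] {T : V →L[𝕜] V} {U : Submodule 𝕜 V}
    (hT : (T : V →ₗ[𝕜] V).IsSymmetric) [(T.ker ⊔ compressedKer T U).HasOrthogonalProjection]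
    {r : ℝ} (hr : 0 < r) (hbound : ∀ u ∈ weakKer T U, u ∈ (T.ker ⊔ compressedKer T U)ᗮ →
      r * ‖u‖ ≤ ‖compress T U u‖) :
    weakKer T U ⊓ (compress T U).ker = T.ker ⊔ compressedKer T U := by
  refine le_antisymm (fun u hu => ?_) fun m hm =>
    ⟨ker_sup_compressedKer_le_weakKer hT hm, compress_eq_zero_of_mem hT hm⟩
  set m := (T.ker ⊔ compressedKer T U).starProjection u
  have hm : m ∈ T.ker ⊔ compressedKer T U := Submodule.starProjection_apply_mem _ u
  have h := hbound (u - m) (sub_mem hu.1 (ker_sup_compressedKer_le_weakKer hT hm))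
    (Submodule.sub_starProjection_mem_orthogonal u)
  rw [map_sub, compress_eq_zero_of_mem hT hm, show compress T U u = 0 from hu.2, sub_zero,
    norm_zero] at h
  rwa [sub_eq_zero.1 (norm_le_zero_iff.1 (nonpos_of_mul_nonpos_right h hr))]

namespace FormPair

variable {H : Type*} [NormedAddCommGroup H] [InnerProductSpace ℂ H] [CompleteSpace H]
  (P : FormPair H) {l μ r ε : ℝ}

theorem G_eq_weakKer : P.G (μ : ℂ) = weakKer (pencil P.a.gram μ) P.H₀ := by
  ext u
  rw [mem_G_iff, P.a.mem_weakKer_gram]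

theorem B_eq_compression : P.B μ = (P.G (μ : ℂ)).orthogonalProjectionOnto ∘L
    pencil P.a.gram μ ∘L (P.G (μ : ℂ)).subtypeL := by
  ext u
  simp [B, pencil_apply, ClosedPositiveForm.gram]

theorem isSelfAdjoint_B : IsSelfAdjoint (P.B μ) := by
  rw [B_eq_compression, ← Submodule.adjoint_subtypeL]
  exact (ContinuousLinearMap.isSelfAdjoint_iff_isSymmetric.2
    (isSymmetric_pencil P.a.isSymmetric_gram)).adjoint_conj _

theorem coe_B_orthogonalProjectionOnto (m : P.a.Space) :
    (P.B μ ((P.G (μ : ℂ)).orthogonalProjectionOnto m) : P.a.Space) =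
      compress (pencil P.a.gram μ) P.H₀ m := by
  have hproj : (P.G (μ : ℂ)).starProjection =
      (weakKer (pencil P.a.gram μ) P.H₀).starProjection := by
    congr!
    exact P.G_eq_weakKer
  rw [B_eq_compression, compress_apply, ← hproj]
  rfl

theorem coe_B_apply (u : P.G (μ : ℂ)) :
    (P.B μ u : P.a.Space) = compress (pencil P.a.gram μ) P.H₀ u := by
  rw [← coe_B_orthogonalProjectionOnto, Submodule.orthogonalProjectionOnto_mem_subspace_eq_self]

theorem inner_B_orthogonalProjectionOnto (m : P.a.Space) :
    inner ℂ (P.B μ ((P.G (μ : ℂ)).orthogonalProjectionOnto m))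
      ((P.G (μ : ℂ)).orthogonalProjectionOnto m) =
        inner ℂ (compress (pencil P.a.gram μ) P.H₀ m) m := by
  rw [Submodule.inner_orthogonalProjectionOnto_eq_of_mem_left, coe_B_orthogonalProjectionOnto]

theorem map_subtype_ker_B : (P.B μ).ker.map (P.G (μ : ℂ)).subtype =
    weakKer (pencil P.a.gram μ) P.H₀ ⊓ (compress (pencil P.a.gram μ) P.H₀).ker := by
  ext u
  rw [← G_eq_weakKer]
  constructor
  · rintro ⟨u, hu, rfl⟩
    exact ⟨u.2, (P.coe_B_apply u).symm.trans (congrArg Subtype.val hu)⟩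
  · rintro ⟨huG, hu⟩
    exact ⟨⟨u, huG⟩, Subtype.ext ((P.coe_B_apply _).trans hu), rfl⟩

theorem spectrumConsistsOf_B_of_test_spaces (hε : 0 < ε) (hεr : ε < r)
    {W X₁ X₂ : Submodule ℂ P.a.Space} [FiniteDimensional ℂ W]
    (hbound : ∀ u ∈ weakKer (pencil P.a.gram μ) P.H₀, u ∈ Wᗮ →
      r * ‖u‖ ≤ ‖compress (pencil P.a.gram μ) P.H₀ u‖)
    (hW : Module.finrank ℂ W ≤ Module.finrank ℂ X₁ + Module.finrank ℂ X₂)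
    (hX₁ : ∀ m ∈ X₁, m ≠ 0 → ‖compress (pencil P.a.gram μ) P.H₀ m‖ ^ 2 <
      ε * -(inner ℂ (compress (pencil P.a.gram μ) P.H₀ m) m).re)
    (hX₂ : ∀ m ∈ X₂, m ≠ 0 → ‖compress (pencil P.a.gram μ) P.H₀ m‖ ^ 2 <
      ε * (inner ℂ (compress (pencil P.a.gram μ) P.H₀ m) m).re) :
    SpectrumConsistsOf (P.B μ) (Set.Ioo (-ε) 0) (Module.finrank ℂ X₁) ∧
      0 ∉ realSpectrum (P.B μ) ∧
      SpectrumConsistsOf (P.B μ) (Set.Ioo 0 ε) (Module.finrank ℂ X₂) := by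
  refine spectrumConsistsOf_of_test_spaces P.isSelfAdjoint_B
    (φ := W.orthogonalProjectionOnto ∘L (P.G (μ : ℂ)).subtypeL) (fun u hu => ?_) hε hεr hW
    ((P.G (μ : ℂ)).orthogonalProjectionOnto.toLinearMap ∘ₗ X₁.subtype) (fun m hm => ?_)
    ((P.G (μ : ℂ)).orthogonalProjectionOnto.toLinearMap ∘ₗ X₂.subtype) (fun m hm => ?_)
  · have h := hbound u (P.G_eq_weakKer.le u.2) (Submodule.orthogonalProjectionOnto_eq_zero_iff.1 hu)
    rwa [← coe_B_apply] at h
  · have h := hX₁ m m.2 fun h => hm (Subtype.ext h)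
    rwa [← inner_B_orthogonalProjectionOnto, ← coe_B_orthogonalProjectionOnto] at h
  · have h := hX₂ m m.2 fun h => hm (Subtype.ext h)
    rwa [← inner_B_orthogonalProjectionOnto, ← coe_B_orthogonalProjectionOnto] at h

section NearLambda

variable [FiniteDimensional ℂ (pencil P.a.gram l).ker]
  [FiniteDimensional ℂ (compressedKer (pencil P.a.gram l) P.H₀)]
  (hε : 0 < ε) (hεr : ε < r)
  (hbound : ∀ u ∈ weakKer (pencil P.a.gram l) P.H₀,
    u ∈ ((pencil P.a.gram l).ker ⊔ compressedKer (pencil P.a.gram l) P.H₀)ᗮ →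
    r * ‖u‖ ≤ ‖compress (pencil P.a.gram l) P.H₀ u‖)
include hε hεr hbound

theorem spectrumConsistsOf_B_self :
    realSpectrum (P.B l) ∩ Set.Ioo (-ε) ε ⊆ {0} ∧
      SpectrumConsistsOf (P.B l) (Set.Ioo (-ε) ε) (P.nN l + P.nD l + P.nND l) := by
  have hker : (P.B l).ker.map (P.G (l : ℂ)).subtype =
      (pencil P.a.gram l).ker ⊔ compressedKer (pencil P.a.gram l) P.H₀ :=
    P.map_subtype_ker_B.trans (weakKer_inf_ker_compress
      (isSymmetric_pencil P.a.isSymmetric_gram) (hε.trans hεr) hbound)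
  have : FiniteDimensional ℂ ((P.B l).ker.map (P.G (l : ℂ)).subtype) := hker ▸ inferInstance
  have : FiniteDimensional ℂ (P.B l).ker :=
    (Submodule.equivMapOfInjective _ (P.G (l : ℂ)).injective_subtype _).symm.finiteDimensional
  rw [← finrank_ker_sup_compressedKer, ← hker,
    finrank_map_of_injective (P.G (l : ℂ)).injective_subtype]
  refine spectrumConsistsOf_finrank_ker P.isSelfAdjoint_B (fun u hu => ?_) hε hεr
  have h := hbound u (P.G_eq_weakKer.le u.2) (hker ▸ ?_)
  · rwa [← coe_B_apply] at h
  · rintro _ ⟨v, hv, rfl⟩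
    exact hu v hv

variable (hclosed : IsClosed (P.H₀.map (pencil P.a.gram l).toLinearMap : Set P.a.Space))
include hclosed

theorem eventually_spectrumConsistsOf_B : ∀ᶠ μ in 𝓝[≠] l,
    (μ < l → SpectrumConsistsOf (P.B μ) (Set.Ioo (-ε) 0) (P.nD l) ∧ 0 ∉ realSpectrum (P.B μ) ∧
      SpectrumConsistsOf (P.B μ) (Set.Ioo 0 ε) (P.nN l)) ∧
    (l < μ → SpectrumConsistsOf (P.B μ) (Set.Ioo (-ε) 0) (P.nN l) ∧ 0 ∉ realSpectrum (P.B μ) ∧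
      SpectrumConsistsOf (P.B μ) (Set.Ioo 0 ε) (P.nD l)) := by
  have hK := P.a.isSymmetric_gram
  obtain ⟨r', hεr', hr'⟩ := exists_between hεr
  filter_upwards [
    eventually_mul_norm_le_norm_compress_pencil hK P.isClosed_H₀ hclosed (hε.trans hεr).le hr'
      hbound,
    eventually_sq_norm_compress_lt_of_mem_commonKer_orthogonal hK P.a.re_inner_gram_nonneg
      P.isClosed_H₀ hclosed hε] with μ hμbound htest
  have hW := P.finrank_orthogonal_commonKer_inf_sup l
  rw [← finrank_orthogonal_commonKer_inf_ker, ← finrank_orthogonal_commonKer_inf_compressedKer]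
    at hW ⊢
  refine ⟨fun hμ => P.spectrumConsistsOf_B_of_test_spaces hε hεr' hμbound
    (hW.le.trans (add_comm _ _).le) (fun m hm hm0 => ?_) (fun m hm hm0 => ?_),
    fun hμ => P.spectrumConsistsOf_B_of_test_spaces hε hεr' hμbound hW.le
      (fun m hm hm0 => ?_) (fun m hm hm0 => ?_)⟩
  · exact lt_mul_neg_of_abs_mul_lt_of_neg (sub_neg.2 hμ) ((htest m hm.1 hm0).2 hm.2)
  · exact lt_mul_of_abs_mul_lt_of_pos (sub_pos.2 hμ) ((htest m hm.1 hm0).1 hm.2)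
  · exact lt_mul_neg_of_abs_mul_lt_of_neg (sub_neg.2 hμ) ((htest m hm.1 hm0).1 hm.2)
  · exact lt_mul_of_abs_mul_lt_of_pos (sub_pos.2 hμ) ((htest m hm.1 hm0).2 hm.2)

end NearLambda

theorem exists_mul_norm_le_norm_compress
    (hN : (l : ℂ) ∉ PartialOp.essSpectrum P.AN) (hD : (l : ℂ) ∉ PartialOp.essSpectrum P.AD)
    (hclosed : IsClosed (P.H₀.map (pencil P.a.gram l).toLinearMap : Set P.a.Space)) :
    ∃ r > 0, ∀ u ∈ weakKer (pencil P.a.gram l) P.H₀,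
      u ∈ ((pencil P.a.gram l).ker ⊔ compressedKer (pencil P.a.gram l) P.H₀)ᗮ →
      r * ‖u‖ ≤ ‖compress (pencil P.a.gram l) P.H₀ u‖ := by
  have : CompleteSpace P.H₀ := P.isClosed_H₀.completeSpace_coe
  obtain ⟨c₁, hc₁, hker⟩ := exists_norm_sub_ker_le _ (P.a.isClosed_range_pencil_gram hN)
  obtain ⟨c₂, hc₂, hcompr⟩ := P.a.exists_norm_sub_compressedKer_le P.dense_H₀ hD
  refine ⟨min c₁ c₂ / 2, half_pos (lt_min hc₁ hc₂), fun u hu huM =>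
    mul_norm_le_norm_compress_of_mem_orthogonal (isSymmetric_pencil P.a.isSymmetric_gram) hclosed
      (lt_min hc₁ hc₂).le (fun v => ?_) (fun v hv => ?_) hu huM⟩
  · obtain ⟨n, hn, h⟩ := hker v
    exact ⟨n, hn, (mul_le_mul_of_nonneg_right (min_le_left _ _) (norm_nonneg _)).trans h⟩
  · obtain ⟨d, hd, h⟩ := hcompr v hv
    exact ⟨d, hd, (mul_le_mul_of_nonneg_right (min_le_right _ _) (norm_nonneg _)).trans h⟩

end FormPair

theorem mainTheorem2_general {H : Type*} [NormedAddCommGroup H] [InnerProductSpace ℂ H]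
    [CompleteSpace H] (P : FormPair H) (l : ℝ)
    (hl : (l : ℂ) ∉ PartialOp.essSpectrum P.AN ∪ PartialOp.essSpectrum P.AD) :
    ∃ ε₀ : ℝ, 0 < ε₀ ∧ ∀ ε : ℝ, 0 < ε → ε < ε₀ → ∃ δ : ℝ, 0 < δ ∧
      (realSpectrum (P.B l) ∩ Set.Ioo (-ε) ε ⊆ {0} ∧
        SpectrumConsistsOf (P.B l) (Set.Ioo (-ε) ε) (P.nN l + P.nD l + P.nND l)) ∧
      (∀ μ ∈ Set.Ioo (l - δ) l,
        SpectrumConsistsOf (P.B μ) (Set.Ioo (-ε) 0) (P.nD l) ∧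
        0 ∉ realSpectrum (P.B μ) ∧
        SpectrumConsistsOf (P.B μ) (Set.Ioo 0 ε) (P.nN l)) ∧
      (∀ μ ∈ Set.Ioo l (l + δ),
        SpectrumConsistsOf (P.B μ) (Set.Ioo (-ε) 0) (P.nN l) ∧
        0 ∉ realSpectrum (P.B μ) ∧
        SpectrumConsistsOf (P.B μ) (Set.Ioo 0 ε) (P.nD l)) := by
  have hN : (l : ℂ) ∉ PartialOp.essSpectrum P.AN := fun h => hl (Or.inl h)
  have hD : (l : ℂ) ∉ PartialOp.essSpectrum P.AD := fun h => hl (Or.inr h)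
  have : FiniteDimensional ℂ (pencil P.a.gram l).ker := P.a.finiteDimensional_ker_pencil_gram hN
  have := P.a.finiteDimensional_compressedKer P.dense_H₀ hD
  have hclosed : IsClosed (P.H₀.map (pencil P.a.gram l).toLinearMap : Set P.a.Space) :=
    isClosed_map_of_finiteDimensional_ker _ (P.a.isClosed_range_pencil_gram hN) P.isClosed_H₀
  obtain ⟨r, hr, hbound⟩ := P.exists_mul_norm_le_norm_compress hN hD hclosed
  refine ⟨r, hr, fun ε hε hεr => ?_⟩
  obtain ⟨δ, hδ, hnear⟩ := Metric.eventually_nhds_iff.1 (eventually_nhdsWithin_iff.1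
    (P.eventually_spectrumConsistsOf_B hε hεr hbound hclosed))
  refine ⟨δ, hδ, P.spectrumConsistsOf_B_self hε hεr hbound, fun μ hμ => ?_, fun μ hμ => ?_⟩
  · exact (hnear (abs_sub_lt_iff.2 ⟨by linarith [hμ.2], by linarith [hμ.1]⟩) hμ.2.ne).1 hμ.2
  · exact (hnear (abs_sub_lt_iff.2 ⟨by linarith [hμ.2], by linarith [hμ.1]⟩) hμ.1.ne').2 hμ.1

theorem mainTheorem2 {H : Type*} [NormedAddCommGroup H] [InnerProductSpace ℂ H]
    [CompleteSpace H] [TopologicalSpace.SeparableSpace H] (hH : ¬ FiniteDimensional ℂ H)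
    (P : FormPair H) (l : ℝ)
    (hl : (l : ℂ) ∉ PartialOp.essSpectrum P.AN ∪ PartialOp.essSpectrum P.AD) :
    ∃ ε₀ : ℝ, 0 < ε₀ ∧ ∀ ε : ℝ, 0 < ε → ε < ε₀ → ∃ δ : ℝ, 0 < δ ∧
      (realSpectrum (P.B l) ∩ Set.Ioo (-ε) ε ⊆ {0} ∧
        SpectrumConsistsOf (P.B l) (Set.Ioo (-ε) ε) (P.nN l + P.nD l + P.nND l)) ∧
      (∀ μ ∈ Set.Ioo (l - δ) l,
        SpectrumConsistsOf (P.B μ) (Set.Ioo (-ε) 0) (P.nD l) ∧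
        0 ∉ realSpectrum (P.B μ) ∧
        SpectrumConsistsOf (P.B μ) (Set.Ioo 0 ε) (P.nN l)) ∧
      (∀ μ ∈ Set.Ioo l (l + δ),
        SpectrumConsistsOf (P.B μ) (Set.Ioo (-ε) 0) (P.nN l) ∧
        0 ∉ realSpectrum (P.B μ) ∧
        SpectrumConsistsOf (P.B μ) (Set.Ioo 0 ε) (P.nD l)) :=
  mainTheorem2_general P l hl
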